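/- **The $G_2$ spider.** Let $\mathcal A=\mathbb C(q)$. The category $\mathcal T(G_2)$ has the natural numbers as objects; its morphisms $m\to n$ are the $\mathcal A$-linear combinations of planar trivalent graphs (possibly with closed circles, and possibly disconnected) embedded in a rectangle, with $m$ boundary points on the bottom edge and $n$ on the top edge, taken up to planar isotopy and modulo the following local relations; composition is vertical stacking. * A closed circle equals $q^{10}+q^8+q^2+1+q^{-2}+q^{-8}+q^{-10}$. * A graph containing a lollipop (a face with one edge) is $0$. * A bigon equals $-(q^6+q^4+q^2+q^{-2}+q^{-4}+q^{-6})$ times a strand. * A triangle equals $q^4+1+q^{-4}$ times a vertex. * A square equals $-(q^2+q^{-2})(I+H)+(q^2+1+q^{-2})(U+\mathrm{id})$. * A pentagon equals the sum of the five planar trivalent trees with its five endpoints, minus the sum of the five forests consisting of an arc joining two neighbouring endpoints and one vertex joined to the other three. Here, with two endpoints at the bottom and two at the top, $I$ is the graph in which the two bottom endpoints merge into a vertical edge that splits again, $H$ consists of two vertical strands joined by a horizontal edge, $U$ is a cap below a cup, and $\mathrm{id}$ is two vertical strands. The crossing is the element $$\sigma=\frac1{1+q^{2}}\,I+\frac1{1+q^{-2}}\,H+\frac1{q^2+q^4}\,U+\frac1{q^{-2}+q^{-4}}\,\mathrm{id}$$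 of $\operatorname{End}_{\mathcal T(G_2)}(2)$. For $1\le i\le n-1$ let $c_i\in \operatorname{End}_{\mathcal T(G_2)}(n)$ be $\sigma$ placed on the strands $i,i+1$, with vertical strands elsewhere. A *basis diagram* is a planar trivalent graph in the rectangle that has no closed circles and in which each internal face (a face not touching the boundary of the rectangle) has at least $6$ edges. **Proposition.** For every $n\ge 0$ the assignment $\sigma_i\mapsto c_i$ on the Artin generators of the braid group $\mathcal B_n$ extends to a homomorphism of $\mathcal A$-algebras $\rho_n:\mathcal A\mathcal B_n\to\operatorname{End}_{\mathcal T(G_2)}(n)$, and every basis diagram with $n$ bottom and $n$ top boundary points in which each connected component contains at most one vertex lies in the image of $\rho_n$. -/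

import Mathlib

open CategoryTheory

noncomputable section

/-! ## Planar trivalent diagrams

A planar trivalent graph in a rectangle, in general position with respect to the height, is cut by
horizontal lines into layers. Each layer contains a single elementary piece (a local minimum, a
local maximum, or a trivalent vertex) between vertical strands. A diagram is the list of its layers,
read from the bottom to the top. Isotopies are among the relations imposed below. -/

namespace G2

/-- The elementary pieces: the local minimum `∪`, the local maximum `∩`, and a trivalent vertex with
two edges going down (`merge`, shaped like `⅄`) or with two edges going up (`split`,
shaped like `Y`). -/
inductive Piece
  | cup | cap | merge | split

/-- The number of endpoints at the bottom of an elementary piece. -/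
def Piece.src : Piece → ℕ
  | cup => 0 | cap => 2 | merge => 2 | split => 1

/-- The number of endpoints at the top of an elementary piece. -/
def Piece.tgt : Piece → ℕ
  | cup => 2 | cap => 0 | merge => 1 | split => 2

/-- Whether the elementary piece is a trivalent vertex. -/
def Piece.IsVertex : Piece → Prop
  | cup => False | cap => False | merge => True | split => True

/-- `count` points on a horizontal line. -/
@[ext] structure Points where
  count : ℕ

/-- A layer: an elementary piece with `left` vertical strands to its left and `right` vertical
strands to its right. -/
structure Layer (m n : Points) where
  piece : Piece
  left : ℕ
  right : ℕ
  bottom_eq : m.count = left + piece.src + right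
  top_eq : n.count = left + piece.tgt + right

instance : Quiver Points := ⟨Layer⟩

/-- `n` points, as an object of the category of diagrams. -/
abbrev pt (n : ℕ) : Paths Points := (Paths.of Points).obj ⟨n⟩

/-- Diagrams in a rectangle, with `m` points on the bottom edge and `n` points on the top edge.
The composition `D ≫ E` stacks `E` on top of `D`. -/
abbrev Diagram (m n : ℕ) := pt m ⟶ pt n

/-- The diagram from `m` to `n` points with the single layer consisting of `g` between `a` strands
on the left and `b` strands on the right. -/
def layer (g : Piece) (a b m n : ℕ)
    (hm : m = a + g.src + b := by first | omega | (simp only [Piece.src] <;> omega))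
    (hn : n = a + g.tgt + b := by first | omega | (simp only [Piece.tgt] <;> omega)) :
    Diagram m n :=
  (Paths.of Points).map (X := ⟨m⟩) (Y := ⟨n⟩) (Layer.mk g a b hm hn)

/-- `n` vertical strands. -/
def idWeb (n : ℕ) : Diagram n n := 𝟙 (pt n)

/-- The strands at the positions `i` and `i + 1` of `n` (counted from `0`) are merged into one
vertical edge, which splits again. -/
def webI (n i : ℕ) (h : i + 2 ≤ n) : Diagram n n :=
  (layer .merge i (n - 2 - i) n (n - 1)) ≫ (layer .split i (n - 2 - i) (n - 1) n)

/-- The strands at the positions `i` and `i + 1` of `n` are joined by a horizontal edge. -/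
def webH (n i : ℕ) (h : i + 2 ≤ n) : Diagram n n :=
  (layer .split i (n - 1 - i) n (n + 1)) ≫ (layer .merge (i + 1) (n - 2 - i) (n + 1) n)

/-- The strands at the positions `i` and `i + 1` of `n` are replaced by a cap below a cup. -/
def webCapCup (n i : ℕ) (h : i + 2 ≤ n) : Diagram n n :=
  (layer .cap i (n - 2 - i) n (n - 2)) ≫ (layer .cup i (n - 2 - i) (n - 2) n)

/-! ## The `G₂` spider -/

/-- The ground field `ℂ(q)`. -/
abbrev Coeff := RatFunc ℂ

/-- The variable `q`. -/
def q : Coeff := RatFunc.X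

/-- Diagrams and their formal `ℂ(q)`-linear combinations, as a category. -/
abbrev FreeSpider := CategoryTheory.Free Coeff (Paths Points)

/-- The object `n` of `FreeSpider`. -/
abbrev freeOb (n : ℕ) : FreeSpider :=
  (Free.embedding Coeff (Paths Points)).obj (pt n)

/-- A diagram as a formal linear combination. -/
def web {m n : ℕ} (D : Diagram m n) : freeOb m ⟶ freeOb n :=
  (Free.embedding Coeff (Paths Points)).map D

/-- Add `a` vertical strands to the left and `b` vertical strands to the right of a diagram. -/
def juxtaposePaths (a b : ℕ) : Paths Points ⥤ Paths Points :=
  Paths.lift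
    { obj := fun m => pt (a + m.count + b)
      map := fun {m n} (l : Layer m n) =>
        (Paths.of Points).map (X := ⟨a + m.count + b⟩) (Y := ⟨a + n.count + b⟩)
          { piece := l.piece
            left := a + l.left
            right := l.right + b
            bottom_eq := by have := l.bottom_eq; dsimp only; omega
            top_eq := by have := l.top_eq; dsimp only; omega } }

/-- Add `a` vertical strands to the left and `b` vertical strands to the right of every diagram in
a formal linear combination. -/
def juxtapose (a b : ℕ) : FreeSpider ⥤ FreeSpider :=
  Free.lift Coeff (juxtaposePaths a b ⋙ Free.embedding Coeff (Paths Points))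

/-- The value of a closed circle. -/
def loopValue : Coeff := q ^ 10 + q ^ 8 + q ^ 2 + 1 + q⁻¹ ^ 2 + q⁻¹ ^ 8 + q⁻¹ ^ 10

/-- The coefficient in the relation removing a bigon. -/
def bigonValue : Coeff := -(q ^ 6 + q ^ 4 + q ^ 2 + q⁻¹ ^ 2 + q⁻¹ ^ 4 + q⁻¹ ^ 6)

/-- The coefficient in the relation contracting a triangle. -/
def triangleValue : Coeff := q ^ 4 + 1 + q⁻¹ ^ 4

/-- The square: two bottom points and two top points, attached to the corners of a square. -/
def squareWeb : Diagram 2 2 := webH 2 0 le_rfl ≫ webH 2 0 le_rfl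

/-- The pentagon: two bottom points and three top points, attached to the corners of a pentagon. -/
def pentagonWeb : Diagram 2 3 :=
  ((webH 2 0 le_rfl ≫ layer .split 0 1 2 3) ≫ layer .split 2 0 3 4) ≫
    layer .merge 1 1 4 3

/-- The five planar trivalent trees with two bottom and three top endpoints, with three vertices
each. They are permuted cyclically by the rotations of the boundary circle. -/
def treeWebs : (freeOb 2 ⟶ freeOb 3) :=
  web ((layer .merge 0 0 2 1 ≫ layer .split 0 0 1 2) ≫ layer .split 0 1 2 3)
  + web ((layer .merge 0 0 2 1 ≫ layer .split 0 0 1 2) ≫ layer .split 1 0 2 3)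
  + web ((layer .split 0 1 2 3 ≫ layer .split 2 0 3 4) ≫ layer .merge 1 1 4 3)
  + web (webH 2 0 le_rfl ≫ layer .split 0 1 2 3)
  + web (webH 2 0 le_rfl ≫ layer .split 1 0 2 3)

/-- The five planar forests with two bottom and three top endpoints that consist of an arc between
neighbouring endpoints and a vertex joined to the other three. They are permuted cyclically by the
rotations of the boundary circle. -/
def forestWebs : (freeOb 2 ⟶ freeOb 3) :=
  web ((layer .cap 0 0 2 0 ≫ layer .cup 0 0 0 2) ≫ layer .split 1 0 2 3)
  + web (layer .split 0 1 2 3)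
  + web (layer .split 1 0 2 3)
  + web (layer .merge 0 0 2 1 ≫ layer .cup 1 0 1 3)
  + web (layer .merge 0 0 2 1 ≫ layer .cup 0 1 1 3)

/-- The relations of the `G₂` spider: the smallest `ℂ(q)`-linear congruence, stable under adding
vertical strands to the left and to the right, that contains the planar isotopies and the local
relations of Kuperberg. -/
inductive Rel : HomRel FreeSpider
  -- planar isotopy: distant pieces slide past each other vertically
  | exchange (g h : Piece) (b : ℕ) :
      Rel
        (web ((layer g 0 (b + h.src) (g.src + b + h.src) (g.tgt + b + h.src)) ≫
          (layer h (g.tgt + b) 0 (g.tgt + b + h.src) (g.tgt + b + h.tgt))))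
        (web ((layer h (g.src + b) 0 (g.src + b + h.src) (g.src + b + h.tgt)) ≫
          (layer g 0 (b + h.tgt) (g.src + b + h.tgt) (g.tgt + b + h.tgt))))
  -- planar isotopy: straightening a zigzag
  | zigzag_left : Rel (web (layer .cup 0 1 1 3 ≫ layer .cap 1 0 3 1)) (web (idWeb 1))
  | zigzag_right : Rel (web (layer .cup 1 0 1 3 ≫ layer .cap 0 1 3 1)) (web (idWeb 1))
  -- planar isotopy: turning one of the edges at a vertex
  | turn_left :
      Rel (web (layer .cup 0 1 1 3 ≫ layer .merge 1 0 3 2)) (web (layer .split 0 0 1 2))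
  | turn_right :
      Rel (web (layer .cup 1 0 1 3 ≫ layer .merge 0 1 3 2)) (web (layer .split 0 0 1 2))
  -- the local relations
  | loop : Rel (web (layer .cup 0 0 0 2 ≫ layer .cap 0 0 2 0)) (loopValue • web (idWeb 0))
  | lollipop : Rel (web (layer .cup 0 0 0 2 ≫ layer .merge 0 0 2 1)) 0
  | bigon :
      Rel (web (layer .split 0 0 1 2 ≫ layer .merge 0 0 2 1)) (bigonValue • web (idWeb 1))
  | triangle :
      Rel (web ((layer .split 0 1 2 3 ≫ layer .merge 1 0 3 2) ≫ layer .merge 0 0 2 1))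
        (triangleValue • web (layer .merge 0 0 2 1))
  | square :
      Rel (web squareWeb)
        (-(q ^ 2 + q⁻¹ ^ 2) • (web (webI 2 0 le_rfl) + web (webH 2 0 le_rfl))
          + (q ^ 2 + 1 + q⁻¹ ^ 2) • (web (webCapCup 2 0 le_rfl) + web (idWeb 2)))
  | pentagon : Rel (web pentagonWeb) (treeWebs - forestWebs)
  -- closure properties
  | refl {X Y : FreeSpider} (f : X ⟶ Y) : Rel f f
  | symm {X Y : FreeSpider} {f g : X ⟶ Y} : Rel f g → Rel g f
  | trans {X Y : FreeSpider} {f g h : X ⟶ Y} : Rel f g → Rel g h → Rel f h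
  | comp_left {X Y Z : FreeSpider} (f : X ⟶ Y) {g h : Y ⟶ Z} : Rel g h → Rel (f ≫ g) (f ≫ h)
  | comp_right {X Y Z : FreeSpider} {f g : X ⟶ Y} (h : Y ⟶ Z) : Rel f g → Rel (f ≫ h) (g ≫ h)
  | add {X Y : FreeSpider} {f f' g g' : X ⟶ Y} : Rel f f' → Rel g g' → Rel (f + g) (f' + g')
  | smul {X Y : FreeSpider} (c : Coeff) {f g : X ⟶ Y} : Rel f g → Rel (c • f) (c • g)
  | juxtapose (a b : ℕ) {X Y : FreeSpider} {f g : X ⟶ Y} :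
      Rel f g → Rel ((juxtapose a b).map f) ((juxtapose a b).map g)

instance : Congruence Rel where
  comp_left f _ _ h := Rel.comp_left f h
  comp_right f h := Rel.comp_right f h
  equivalence := ⟨Rel.refl, Rel.symm, Rel.trans⟩

/-- The `G₂` spider: its objects are the natural numbers, its morphisms are the linear combinations
of diagrams modulo the relations. -/
abbrev Spider := CategoryTheory.Quotient Rel

instance : Preadditive Spider :=
  Quotient.preadditive Rel (fun _ _ _ _ _ _ h h' => Rel.add h h')

instance : (Quotient.functor Rel).Additive :=
  Quotient.functor_additive Rel (fun _ _ _ _ _ _ h h' => Rel.add h h')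

instance : Linear Coeff Spider :=
  Quotient.linear Coeff Rel (fun c _ _ _ _ h => Rel.smul c h)

/-- The object `n` of the spider. -/
abbrev ob (n : ℕ) : Spider := (Quotient.functor Rel).obj (freeOb n)

/-- The morphism of the spider given by a diagram. -/
def toSpider {m n : ℕ} (D : Diagram m n) : ob m ⟶ ob n := (Quotient.functor Rel).map (web D)

/-- The diagram algebra of the spider with `n` points on both edges. -/
abbrev EndAlg (n : ℕ) := CategoryTheory.End (ob n)

/-! ## The braid group and the crossing -/

/-- The relations of Artin's presentation of the braid group on `n` strands, with generators
`σ₀, …, σ_{n-2}`. -/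
def braidRels (n : ℕ) : Set (FreeGroup (Fin (n - 1))) :=
  {r | ∃ i j : Fin (n - 1), (i : ℕ) + 1 < j ∧
      r = (.of i * .of j) * (FreeGroup.of j * .of i)⁻¹} ∪
  {r | ∃ i j : Fin (n - 1), (i : ℕ) + 1 = j ∧
      r = (.of i * .of j * .of i) * (FreeGroup.of j * .of i * .of j)⁻¹}

/-- The braid group on `n` strands. -/
abbrev BraidGroup (n : ℕ) := PresentedGroup (braidRels n)

/-- The generator `σ_i` of the braid group, which crosses the strands `i` and `i + 1`. -/
def braidGen (n : ℕ) (i : Fin (n - 1)) : BraidGroup n := PresentedGroup.of i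

/-- The crossing of the strands `i` and `i + 1`, as an element of the diagram algebra. -/
def crossing (n : ℕ) (i : Fin (n - 1)) : EndAlg n :=
  have h : (i : ℕ) + 2 ≤ n := by omega
  ((1 + q ^ 2)⁻¹ • toSpider (webI n i h) + (1 + q⁻¹ ^ 2)⁻¹ • toSpider (webH n i h)
    + (q ^ 2 + q ^ 4)⁻¹ • toSpider (webCapCup n i h)
    + (q⁻¹ ^ 2 + q⁻¹ ^ 4)⁻¹ • toSpider (idWeb n) : ob n ⟶ ob n)

/-! ## Components, faces and basis diagrams

The horizontal lines separating the layers of a diagram are numbered from `0` (the bottom edge of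
the rectangle) to the number of layers (the top edge). The `j`-th strand met by the line `k`, both
counted from `0`, is recorded as the pair `(k, j)`. The line `k` is cut into intervals by the
strands; the interval to the left of the `j`-th strand is also recorded as `(k, j)`, and the last
interval as `(k, w)` when there are `w` strands. -/

/-- The layers of a diagram from the bottom to the top, each as a triple of the elementary piece,
the number of strands to its left and the number of strands to its right. -/
def layers {X : Points} : {Y : Points} → Quiver.Path X Y → List (Piece × ℕ × ℕ)
  | _, .nil => []
  | _, .cons p (l : Layer _ _) => layers p ++ [(l.piece, l.left, l.right)]

/-- The number of strands met by each of the horizontal lines, from the bottom to the top. -/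
def widths {X : Points} : {Y : Points} → Quiver.Path X Y → List ℕ
  | _, .nil => [X.count]
  | Y, .cons p _ => widths p ++ [Y.count]

variable {m n : ℕ}

/-- The number of layers of a diagram. -/
def height (D : Diagram m n) : ℕ := Quiver.Path.length (a := Points.mk m) (b := Points.mk n) D

/-- The number of strands met by the `k`-th horizontal line is `w`. -/
def WidthAt (D : Diagram m n) (k w : ℕ) : Prop :=
  (widths (X := ⟨m⟩) (Y := ⟨n⟩) D)[k]? = some w

/-- The `k`-th layer of `D`, between the lines `k` and `k + 1`, is the piece `g` between `a` strands
on the left and `b` strands on the right. -/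
def LayerAt (D : Diagram m n) (k : ℕ) (g : Piece) (a b : ℕ) : Prop :=
  (layers (X := ⟨m⟩) (Y := ⟨n⟩) D)[k]? = some (g, a, b)

/-- `(k, j)` is a strand met by a horizontal line of the diagram. -/
def IsStrand (D : Diagram m n) (p : ℕ × ℕ) : Prop := ∃ w, WidthAt D p.1 w ∧ p.2 < w

/-- `(k, j)` is an interval of a horizontal line of the diagram. -/
def IsInterval (D : Diagram m n) (p : ℕ × ℕ) : Prop := ∃ w, WidthAt D p.1 w ∧ p.2 ≤ w

/-- Two strands are connected by a curve that stays within a layer and avoids the vertices. -/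
inductive EdgeStep (D : Diagram m n) : ℕ × ℕ → ℕ × ℕ → Prop
  | left {k g a b} (j : ℕ) : LayerAt D k g a b → j < a → EdgeStep D (k, j) (k + 1, j)
  | right {k g a b} (j : ℕ) : LayerAt D k g a b → j < b →
      EdgeStep D (k, a + g.src + j) (k + 1, a + g.tgt + j)
  | cup {k a b} : LayerAt D k .cup a b → EdgeStep D (k + 1, a) (k + 1, a + 1)
  | cap {k a b} : LayerAt D k .cap a b → EdgeStep D (k, a) (k, a + 1)

/-- Two strands belong to the same edge of the graph (edges end at vertices and at the boundary). -/
def SameEdge (D : Diagram m n) : ℕ × ℕ → ℕ × ℕ → Prop := Relation.EqvGen (EdgeStep D)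

/-- `D` has a vertex in the layer `k`. -/
def VertexAt (D : Diagram m n) (k : ℕ) : Prop := ∃ g a b, LayerAt D k g a b ∧ g.IsVertex

/-- The strand `p` ends at the vertex in the layer `k`. -/
inductive EndsAtVertex (D : Diagram m n) : ℕ × ℕ → ℕ → Prop
  | below {k g a b} (j : ℕ) : LayerAt D k g a b → g.IsVertex → j < g.src →
      EndsAtVertex D (k, a + j) k
  | above {k g a b} (j : ℕ) : LayerAt D k g a b → g.IsVertex → j < g.tgt →
      EndsAtVertex D (k + 1, a + j) k

/-- Two strands belong to the same connected component of the graph. -/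
def SameComponent (D : Diagram m n) : ℕ × ℕ → ℕ × ℕ → Prop :=
  Relation.EqvGen fun p p' =>
    EdgeStep D p p' ∨ ∃ k, EndsAtVertex D p k ∧ EndsAtVertex D p' k

/-- Every connected component of the graph contains at most one vertex. -/
def AtMostOneVertexPerComponent (D : Diagram m n) : Prop :=
  ∀ k k' p p', EndsAtVertex D p k → EndsAtVertex D p' k' → SameComponent D p p' → k = k'

/-- No component of the graph is a closed loop without vertices: every edge ends at a vertex or at
a boundary point. -/
def NoLoops (D : Diagram m n) : Prop :=
  ∀ p, IsStrand D p → ∃ p', SameEdge D p p' ∧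
    (p'.1 = 0 ∨ p'.1 = height D ∨ ∃ k, EndsAtVertex D p' k)

/-- Two intervals are connected by a curve that stays within a layer and avoids the graph. -/
inductive FaceStep (D : Diagram m n) : ℕ × ℕ → ℕ × ℕ → Prop
  | left {k g a b} (j : ℕ) : LayerAt D k g a b → j ≤ a → FaceStep D (k, j) (k + 1, j)
  | right {k g a b} (j : ℕ) : LayerAt D k g a b → j ≤ b →
      FaceStep D (k, a + g.src + j) (k + 1, a + g.tgt + j)

/-- Two intervals lie in the same face, that is, in the same component of the complement of the
graph in the rectangle. -/
def SameFace (D : Diagram m n) : ℕ × ℕ → ℕ × ℕ → Prop := Relation.EqvGen (FaceStep D)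

/-- The interval `f` touches the boundary of the rectangle. -/
def OnBoundary (D : Diagram m n) (f : ℕ × ℕ) : Prop :=
  f.1 = 0 ∨ f.1 = height D ∨ f.2 = 0 ∨ WidthAt D f.1 f.2

/-- The face containing the interval `f` does not touch the boundary of the rectangle. -/
def IsInternal (D : Diagram m n) (f : ℕ × ℕ) : Prop := ∀ f', SameFace D f f' → ¬ OnBoundary D f'

/-- The edges bordering the face that contains the interval `f`. -/
def bordering (D : Diagram m n) (f : ℕ × ℕ) : Set (Quot (SameEdge D)) :=
  Quot.mk (SameEdge D) ''
    {p | IsStrand D p ∧ (SameFace D f p ∨ SameFace D f (p.1, p.2 + 1))}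

/-- A basis diagram: there are no loops, and every internal face has at least six edges. -/
def IsBasisDiagram (D : Diagram m n) : Prop :=
  NoLoops D ∧ ∀ f, IsInterval D f → IsInternal D f → 6 ≤ (bordering D f).encard

end G2

end

noncomputable section

namespace G2

/-! On two strands, I, H, U and the identity are closed under composition, with an explicit
multiplication table (`comb_comp`). The crossing is therefore invertible, its inverse having the
same coefficients with those of I, H and of U, id exchanged. The crossing acts on I by −q⁻⁶ and on U
by q⁻¹², and modulo I and U it has eigenvalues q² and −1. Polynomials in it thus isolate U, then I,
then H (`gen_U`, `gen_I`, `gen_H`).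

A strand slides past a split (`split_cross`) by a comparison of ten coefficients that uses the
pentagon relation. A quarter turn exchanges the crossing with its inverse (`comb_cap`), which yields
the slide past a merge. The product of two neighbouring crossings therefore intertwines I and H on
one pair of strands with I and H on the next. By the square relation it also intertwines U, and so
the crossing itself; this is the braid relation `cr_braid`.

For the image, a diagram with at most one vertex per component is rewritten, up to a scalar, as caps
and merges followed by cups and splits (`LabelledUpWord.comp_down`, `reducible_of_path`). Every cap
or merge is pushed down past the cups and splits below it. On contact, a circle, a zigzag, a
lollipop or a bent leg of a vertex is removed. The only other contact, a split meeting a merge,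
would put two vertices in one component; strand labels recording the components exclude it.

It remains to generate every product of a down word with an up word (`DownWord.comp_upWord`).
Elements generated by crossings can be pulled through cups and splits, at the price of another
generated element. An up word thus becomes nested cups at the right end, followed by at most one
split of the last strand, and then a generated element; a pair of splits is traded for a cup. Down
words behave dually, and parity makes the two normal forms match. The essential input is that a
merge followed by a split in a neighbouring position is generated (`gen_merge_split_aux`), which is
linear algebra with the square and pentagon relations on three strands. -/

/-! ## Elementary pieces at arbitrary positions -/

/-- The functor adding `a` strands on the left and `b` strands on the right. -/
def juxFunctor (a b : ℕ) : Spider ⥤ Spider :=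
  CategoryTheory.Quotient.lift Rel (juxtapose a b ⋙ CategoryTheory.Quotient.functor Rel)
    (fun _ _ _ _ h => CategoryTheory.Quotient.sound Rel (Rel.juxtapose a b h))

/-- Adding `a` strands on the left and `b` strands on the right of a morphism of the spider. -/
def jux (a b : ℕ) {m n : ℕ} (f : ob m ⟶ ob n) : ob (a + m + b) ⟶ ob (a + n + b) :=
  (juxFunctor a b).map f

instance (a b : ℕ) : (juxtapose a b).Additive := by
  unfold juxtapose; infer_instance

instance (a b : ℕ) : (juxtapose a b).Linear Coeff := by
  unfold juxtapose; infer_instance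

lemma functor_map_smul (c : Coeff) {X Y : FreeSpider} (f : X ⟶ Y) :
    (CategoryTheory.Quotient.functor Rel).map (c • f)
      = c • (CategoryTheory.Quotient.functor Rel).map f := rfl

lemma jux_id (a b n : ℕ) : jux a b (𝟙 (ob n)) = 𝟙 (ob (a + n + b)) :=
  (juxFunctor a b).map_id _

lemma jux_comp (a b : ℕ) {m n p : ℕ} (f : ob m ⟶ ob n) (g : ob n ⟶ ob p) :
    jux a b (f ≫ g) = jux a b f ≫ jux a b g :=
  (juxFunctor a b).map_comp _ _

lemma jux_map (a b : ℕ) {m n : ℕ} (f : freeOb m ⟶ freeOb n) :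
    jux a b ((CategoryTheory.Quotient.functor Rel).map f)
      = (CategoryTheory.Quotient.functor Rel).map ((juxtapose a b).map f) := rfl

lemma jux_add (a b : ℕ) {m n : ℕ} (f g : ob m ⟶ ob n) :
    jux a b (f + g) = jux a b f + jux a b g := by
  obtain ⟨f, rfl⟩ := (CategoryTheory.Quotient.functor Rel).map_surjective f
  obtain ⟨g, rfl⟩ := (CategoryTheory.Quotient.functor Rel).map_surjective g
  rw [← Functor.map_add, jux_map, jux_map, jux_map, Functor.map_add, Functor.map_add]
  rfl

lemma jux_smul (a b : ℕ) (c : Coeff) {m n : ℕ} (f : ob m ⟶ ob n) :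
    jux a b (c • f) = c • jux a b f := by
  obtain ⟨f, rfl⟩ := (CategoryTheory.Quotient.functor Rel).map_surjective f
  rw [← functor_map_smul, jux_map, jux_map, Functor.map_smul, functor_map_smul]
  rfl

lemma jux_zero (a b : ℕ) {m n : ℕ} : jux a b (0 : ob m ⟶ ob n) = 0 := by
  simpa using jux_smul a b 0 (0 : ob m ⟶ ob n)

/-- The piece `g` with `i` strands to its left, as a morphism from `m` to `n` points. It is `0`
when the numbers do not fit. -/
def el (g : Piece) (i m n : ℕ) : ob m ⟶ ob n :=
  if h : i + g.src ≤ m ∧ n + g.src = m + g.tgt then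
    toSpider (layer g i (m - g.src - i) m n (by omega) (by omega)) else 0

lemma el_eq (g : Piece) (i r m n : ℕ) (hm : m = i + g.src + r) (hn : n = i + g.tgt + r) :
    toSpider (layer g i r m n hm hn) = el g i m n := by
  have h : i + g.src ≤ m ∧ n + g.src = m + g.tgt := by omega
  obtain rfl : r = m - g.src - i := by omega
  rw [el, dif_pos h]

lemma toSpider_comp {m n p : ℕ} (D : Diagram m n) (E : Diagram n p) :
    toSpider (D ≫ E) = toSpider D ≫ toSpider E := by
  simp only [toSpider, web, Functor.map_comp]

lemma toSpider_id (n : ℕ) : toSpider (idWeb n) = 𝟙 (ob n) := by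
  rw [toSpider, web, idWeb, CategoryTheory.Functor.map_id]
  exact (CategoryTheory.Quotient.functor Rel).map_id _

lemma jux_toSpider_layer (a b : ℕ) (g : Piece) (i r m n : ℕ) (hm : m = i + g.src + r)
    (hn : n = i + g.tgt + r) :
    jux a b (toSpider (layer g i r m n hm hn))
      = toSpider (layer g (a + i) (r + b) (a + m + b) (a + n + b) (by omega) (by omega)) := by
  simp only [toSpider, jux_map]
  congr 1
  simp only [web, juxtapose]
  erw [Free.lift_map_single]
  simp only [one_smul]
  rfl

lemma jux_el (a b : ℕ) (g : Piece) (i m n : ℕ) (h : i + g.src ≤ m)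
    (h' : n + g.src = m + g.tgt) :
    jux a b (el g i m n) = el g (a + i) (a + m + b) (a + n + b) := by
  rw [← el_eq g i (m - g.src - i) m n (by omega) (by omega), jux_toSpider_layer, el_eq]

/-! ## The relations in every width -/

lemma map_eq_of_rel {m n : ℕ} {f g : freeOb m ⟶ freeOb n} (h : Rel f g) :
    (CategoryTheory.Quotient.functor Rel).map f
      = (CategoryTheory.Quotient.functor Rel).map g := CategoryTheory.Quotient.sound Rel h

lemma el_exchange (g h : Piece) (i j m n n' p j' : ℕ) (hij : i + g.src ≤ j) (hj : j + h.src ≤ m)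
    (hj' : j' + g.src = j + g.tgt) (hn : n + g.src = m + g.tgt) (hn' : n' + h.src = m + h.tgt)
    (hp : p + h.src = n + h.tgt) :
    el g i m n ≫ el h j' n p = el h j m n' ≫ el g i n' p := by
  obtain ⟨b, rfl⟩ := Nat.exists_eq_add_of_le hij
  obtain ⟨c, rfl⟩ := Nat.exists_eq_add_of_le hj
  obtain rfl : j' = i + g.tgt + b := by omega
  obtain rfl : n = i + (g.tgt + b + h.src) + c := by omega
  obtain rfl : n' = i + (g.src + b + h.tgt) + c := by omega
  obtain rfl : p = i + (g.tgt + b + h.tgt) + c := by omega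
  have e := congrArg (jux i c) (map_eq_of_rel (Rel.exchange g h b))
  change jux i c (toSpider _) = jux i c (toSpider _) at e
  simp only [toSpider_comp, jux_comp, jux_toSpider_layer] at e
  simp only [el_eq] at e
  have h1 : i + g.src + b + h.src + c = i + (g.src + b + h.src) + c := by omega
  rw [h1]
  simpa only [Nat.add_assoc, Nat.add_zero] using e

lemma cup_cap_right (i m n : ℕ) (hi : i + 1 ≤ m) (hn : n = m + 2) :
    el .cup i m n ≫ el .cap (i + 1) n m = 𝟙 (ob m) := by
  obtain ⟨b, rfl⟩ := Nat.exists_eq_add_of_le hi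
  obtain rfl : n = i + 3 + b := by omega
  have e : jux i b (el .cup 0 1 3 ≫ el .cap 1 3 1) = jux i b (𝟙 (ob 1)) := by
    rw [← toSpider_id, ← el_eq .cup 0 1 1 3 rfl rfl, ← el_eq .cap 1 0 3 1 rfl rfl,
      ← toSpider_comp]
    exact congrArg (jux i b) (map_eq_of_rel Rel.zigzag_left)
  rw [jux_id, jux_comp, jux_el i b .cup 0 1 3 (by decide) (by decide),
    jux_el i b .cap 1 3 1 (by decide) (by decide)] at e
  simpa only [Nat.add_zero] using e

lemma cup_cap_left (i m n : ℕ) (hi : i + 1 ≤ m) (hn : n = m + 2) :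
    el .cup (i + 1) m n ≫ el .cap i n m = 𝟙 (ob m) := by
  obtain ⟨b, rfl⟩ := Nat.exists_eq_add_of_le hi
  obtain rfl : n = i + 3 + b := by omega
  have e : jux i b (el .cup 1 1 3 ≫ el .cap 0 3 1) = jux i b (𝟙 (ob 1)) := by
    rw [← toSpider_id, ← el_eq .cup 1 0 1 3 rfl rfl, ← el_eq .cap 0 1 3 1 rfl rfl,
      ← toSpider_comp]
    exact congrArg (jux i b) (map_eq_of_rel Rel.zigzag_right)
  rw [jux_id, jux_comp, jux_el i b .cup 1 1 3 (by decide) (by decide),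
    jux_el i b .cap 0 3 1 (by decide) (by decide)] at e
  simpa only [Nat.add_zero] using e

lemma cup_merge_right (i m n p : ℕ) (hi : i + 1 ≤ m) (hn : n = m + 2) (hp : p = m + 1) :
    el .cup i m n ≫ el .merge (i + 1) n p = el .split i m p := by
  obtain ⟨b, rfl⟩ := Nat.exists_eq_add_of_le hi
  obtain rfl : n = i + 3 + b := by omega
  obtain rfl : p = i + 2 + b := by omega
  have e : jux i b (el .cup 0 1 3 ≫ el .merge 1 3 2) = jux i b (el .split 0 1 2) := by
    rw [← el_eq .cup 0 1 1 3 rfl rfl, ← el_eq .merge 1 0 3 2 rfl rfl,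
      ← el_eq .split 0 0 1 2 rfl rfl,
      ← toSpider_comp]
    exact congrArg (jux i b) (map_eq_of_rel Rel.turn_left)
  rw [jux_comp, jux_el i b .cup 0 1 3 (by decide) (by decide),
    jux_el i b .merge 1 3 2 (by decide) (by decide),
    jux_el i b .split 0 1 2 (by decide) (by decide)] at e
  simpa only [Nat.add_zero] using e

lemma cup_merge_left (i m n p : ℕ) (hi : i + 1 ≤ m) (hn : n = m + 2) (hp : p = m + 1) :
    el .cup (i + 1) m n ≫ el .merge i n p = el .split i m p := by
  obtain ⟨b, rfl⟩ := Nat.exists_eq_add_of_le hi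
  obtain rfl : n = i + 3 + b := by omega
  obtain rfl : p = i + 2 + b := by omega
  have e : jux i b (el .cup 1 1 3 ≫ el .merge 0 3 2) = jux i b (el .split 0 1 2) := by
    rw [← el_eq .cup 1 0 1 3 rfl rfl, ← el_eq .merge 0 1 3 2 rfl rfl,
      ← el_eq .split 0 0 1 2 rfl rfl,
      ← toSpider_comp]
    exact congrArg (jux i b) (map_eq_of_rel Rel.turn_right)
  rw [jux_comp, jux_el i b .cup 1 1 3 (by decide) (by decide),
    jux_el i b .merge 0 3 2 (by decide) (by decide),
    jux_el i b .split 0 1 2 (by decide) (by decide)] at e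
  simpa only [Nat.add_zero] using e

lemma cup_cap_self (i m n : ℕ) (hi : i ≤ m) (hn : n = m + 2) :
    el .cup i m n ≫ el .cap i n m = loopValue • 𝟙 (ob m) := by
  obtain ⟨b, rfl⟩ := Nat.exists_eq_add_of_le hi
  obtain rfl : n = i + 2 + b := by omega
  have e : jux i b (el .cup 0 0 2 ≫ el .cap 0 2 0) = jux i b (loopValue • 𝟙 (ob 0)) := by
    rw [← toSpider_id, ← el_eq .cup 0 0 0 2 rfl rfl, ← el_eq .cap 0 0 2 0 rfl rfl,
      ← toSpider_comp]
    exact congrArg (jux i b) (map_eq_of_rel Rel.loop)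
  rw [jux_smul, jux_id, jux_comp, jux_el i b .cup 0 0 2 (by decide) (by decide),
    jux_el i b .cap 0 2 0 (by decide) (by decide)] at e
  simpa only [Nat.add_zero] using e

lemma cup_merge_self (i m n p : ℕ) (hi : i ≤ m) (hn : n = m + 2) (hp : p = m + 1) :
    el .cup i m n ≫ el .merge i n p = 0 := by
  obtain ⟨b, rfl⟩ := Nat.exists_eq_add_of_le hi
  obtain rfl : n = i + 2 + b := by omega
  obtain rfl : p = i + 1 + b := by omega
  have e : jux i b (el .cup 0 0 2 ≫ el .merge 0 2 1) = jux i b 0 := by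
    rw [← el_eq .cup 0 0 0 2 rfl rfl, ← el_eq .merge 0 0 2 1 rfl rfl,
      ← toSpider_comp]
    exact congrArg (jux i b) ((map_eq_of_rel Rel.lollipop).trans (Functor.map_zero _ _ _))
  rw [jux_zero, jux_comp, jux_el i b .cup 0 0 2 (by decide) (by decide),
    jux_el i b .merge 0 2 1 (by decide) (by decide)] at e
  simpa only [Nat.add_zero] using e

lemma split_merge_self (i m n : ℕ) (hi : i + 1 ≤ m) (hn : n = m + 1) :
    el .split i m n ≫ el .merge i n m = bigonValue • 𝟙 (ob m) := by
  obtain ⟨b, rfl⟩ := Nat.exists_eq_add_of_le hi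
  obtain rfl : n = i + 2 + b := by omega
  have e : jux i b (el .split 0 1 2 ≫ el .merge 0 2 1) = jux i b (bigonValue • 𝟙 (ob 1)) := by
    rw [← toSpider_id, ← el_eq .split 0 0 1 2 rfl rfl, ← el_eq .merge 0 0 2 1 rfl rfl,
      ← toSpider_comp]
    exact congrArg (jux i b) (map_eq_of_rel Rel.bigon)
  rw [jux_smul, jux_id, jux_comp, jux_el i b .split 0 1 2 (by decide) (by decide),
    jux_el i b .merge 0 2 1 (by decide) (by decide)] at e
  simpa only [Nat.add_zero] using e

lemma triangle_rel : el .split 0 2 3 ≫ el .merge 1 3 2 ≫ el .merge 0 2 1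
    = triangleValue • el .merge 0 2 1 := by
  have e : toSpider ((layer .split 0 1 2 3 ≫ layer .merge 1 0 3 2) ≫ layer .merge 0 0 2 1)
      = triangleValue • toSpider (layer .merge 0 0 2 1) := map_eq_of_rel Rel.triangle
  rw [← el_eq .split 0 1 2 3 rfl rfl, ← el_eq .merge 1 0 3 2 rfl rfl,
    ← el_eq .merge 0 0 2 1 rfl rfl]
  simpa only [toSpider_comp, Category.assoc] using e

/-! ## Diagrams on two strands -/

/-- The diagram `I` on two strands. -/
def I₂ : ob 2 ⟶ ob 2 := el .merge 0 2 1 ≫ el .split 0 1 2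

/-- The diagram `H` on two strands. -/
def H₂ : ob 2 ⟶ ob 2 := el .split 0 2 3 ≫ el .merge 1 3 2

/-- The diagram `U` on two strands. -/
def U₂ : ob 2 ⟶ ob 2 := el .cap 0 2 0 ≫ el .cup 0 0 2

lemma toSpider_webI (n i : ℕ) (h : i + 2 ≤ n) :
    toSpider (webI n i h) = el .merge i n (n - 1) ≫ el .split i (n - 1) n := by
  simp only [webI, toSpider_comp, el_eq]

lemma toSpider_webH (n i : ℕ) (h : i + 2 ≤ n) :
    toSpider (webH n i h) = el .split i n (n + 1) ≫ el .merge (i + 1) (n + 1) n := by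
  simp only [webH, toSpider_comp, el_eq]

lemma toSpider_webCapCup (n i : ℕ) (h : i + 2 ≤ n) :
    toSpider (webCapCup n i h) = el .cap i n (n - 2) ≫ el .cup i (n - 2) n := by
  simp only [webCapCup, toSpider_comp, el_eq]

lemma square_rel : H₂ ≫ H₂ = -(q ^ 2 + q⁻¹ ^ 2) • (I₂ + H₂)
    + (q ^ 2 + 1 + q⁻¹ ^ 2) • (U₂ + 𝟙 (ob 2)) := by
  have e : toSpider (webH 2 0 le_rfl ≫ webH 2 0 le_rfl)
      = -(q ^ 2 + q⁻¹ ^ 2) • (toSpider (webI 2 0 le_rfl) + toSpider (webH 2 0 le_rfl))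
        + (q ^ 2 + 1 + q⁻¹ ^ 2) • (toSpider (webCapCup 2 0 le_rfl) + toSpider (idWeb 2)) := by
    have e := map_eq_of_rel Rel.square
    simp only [functor_map_smul, Functor.map_add] at e
    exact e
  simp only [toSpider_comp, toSpider_id, toSpider_webI, toSpider_webH, toSpider_webCapCup] at e
  exact e

lemma pentagon_rel :
    H₂ ≫ el .split 0 2 3 ≫ el .split 2 3 4 ≫ el .merge 1 4 3
      = (I₂ ≫ el .split 0 2 3 + I₂ ≫ el .split 1 2 3
        + el .split 0 2 3 ≫ el .split 2 3 4 ≫ el .merge 1 4 3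
        + H₂ ≫ el .split 0 2 3 + H₂ ≫ el .split 1 2 3)
      - (U₂ ≫ el .split 1 2 3 + el .split 0 2 3 + el .split 1 2 3
        + el .merge 0 2 1 ≫ el .cup 1 1 3 + el .merge 0 2 1 ≫ el .cup 0 1 3) := by
  have e : toSpider (((webH 2 0 le_rfl ≫ layer .split 0 1 2 3) ≫ layer .split 2 0 3 4) ≫
        layer .merge 1 1 4 3)
      = (toSpider ((layer .merge 0 0 2 1 ≫ layer .split 0 0 1 2) ≫ layer .split 0 1 2 3)
        + toSpider ((layer .merge 0 0 2 1 ≫ layer .split 0 0 1 2) ≫ layer .split 1 0 2 3)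
        + toSpider ((layer .split 0 1 2 3 ≫ layer .split 2 0 3 4) ≫ layer .merge 1 1 4 3)
        + toSpider (webH 2 0 le_rfl ≫ layer .split 0 1 2 3)
        + toSpider (webH 2 0 le_rfl ≫ layer .split 1 0 2 3))
      - (toSpider ((layer .cap 0 0 2 0 ≫ layer .cup 0 0 0 2) ≫ layer .split 1 0 2 3)
        + toSpider (layer .split 0 1 2 3)
        + toSpider (layer .split 1 0 2 3)
        + toSpider (layer .merge 0 0 2 1 ≫ layer .cup 1 0 1 3)
        + toSpider (layer .merge 0 0 2 1 ≫ layer .cup 0 1 1 3)) := by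
    have e := map_eq_of_rel Rel.pentagon
    simp only [treeWebs, forestWebs, Functor.map_add, Functor.map_sub] at e
    exact e
  simp only [toSpider_comp, toSpider_webH, Category.assoc] at e
  have h1 : el .split 0 1 2 = toSpider (layer .split 0 0 1 2) :=
    (el_eq .split 0 0 1 2 rfl rfl).symm
  have h2 : el .split 1 2 3 = toSpider (layer .split 1 0 2 3) :=
    (el_eq .split 1 0 2 3 rfl rfl).symm
  have h3 : el .split 0 2 3 = toSpider (layer .split 0 1 2 3) :=
    (el_eq .split 0 1 2 3 rfl rfl).symm
  have h4 : el .split 2 3 4 = toSpider (layer .split 2 0 3 4) :=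
    (el_eq .split 2 0 3 4 rfl rfl).symm
  have h5 : el .merge 1 4 3 = toSpider (layer .merge 1 1 4 3) :=
    (el_eq .merge 1 1 4 3 rfl rfl).symm
  have h6 : el .merge 0 2 1 = toSpider (layer .merge 0 0 2 1) :=
    (el_eq .merge 0 0 2 1 rfl rfl).symm
  have h7 : el .cup 0 0 2 = toSpider (layer .cup 0 0 0 2) :=
    (el_eq .cup 0 0 0 2 rfl rfl).symm
  have h8 : el .cap 0 2 0 = toSpider (layer .cap 0 0 2 0) :=
    (el_eq .cap 0 0 2 0 rfl rfl).symm
  have h9 : el .cup 1 1 3 = toSpider (layer .cup 1 0 1 3) :=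
    (el_eq .cup 1 0 1 3 rfl rfl).symm
  have h10 : el .cup 0 1 3 = toSpider (layer .cup 0 1 1 3) :=
    (el_eq .cup 0 1 1 3 rfl rfl).symm
  simp only [← h1, ← h2, ← h3, ← h4, ← h5, ← h6, ← h7, ← h8, ← h9, ← h10] at e
  simpa only [I₂, H₂, U₂, Category.assoc] using e

/-! ## Planar isotopies -/

lemma exch (g h : Piece) (i j m n n' p j' : ℕ)
    (hij : i + g.src ≤ j := by simp only [Piece.src] <;> omega)
    (hj : j + h.src ≤ m := by simp only [Piece.src] <;> omega)
    (hj' : j' + g.src = j + g.tgt := by simp only [Piece.src, Piece.tgt] <;> omega)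
    (hn : n + g.src = m + g.tgt := by simp only [Piece.src, Piece.tgt] <;> omega)
    (hn' : n' + h.src = m + h.tgt := by simp only [Piece.src, Piece.tgt] <;> omega)
    (hp : p + h.src = n + h.tgt := by simp only [Piece.src, Piece.tgt] <;> omega) :
    el g i m n ≫ el h j' n p = el h j m n' ≫ el g i n' p :=
  el_exchange g h i j m n n' p j' hij hj hj' hn hn' hp

/-- A split is a merge with one leg bent up by a cup; the cap straightens that leg again. -/
lemma split_cap_right (i m n p : ℕ) (hi : i + 2 ≤ m := by omega) (hn : n = m + 1 := by omega)
    (hp : p + 1 = m := by omega) :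
    el .split i m n ≫ el .cap (i + 1) n p = el .merge i m p := by
  rw [← cup_merge_left i m (m + 2) n (by omega) rfl hn, Category.assoc,
    exch .merge .cap i (i + 2) (m + 2) n m p (i + 1),
    ← Category.assoc, cup_cap_right (i + 1) m (m + 2) (by omega) rfl, Category.id_comp]

lemma split_cap_left (i m n p : ℕ) (hi : i + 2 ≤ m := by omega) (hn : n = m + 1 := by omega)
    (hp : p + 1 = m := by omega) :
    el .split (i + 1) m n ≫ el .cap i n p = el .merge i m p := by
  rw [← cup_merge_right (i + 1) m (m + 2) n (by omega) rfl hn, Category.assoc,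
    ← exch .cap .merge i (i + 2) (m + 2) m n p i,
    ← Category.assoc, cup_cap_left i m (m + 2) (by omega) rfl, Category.id_comp]

/-- Both sides are one cup with a merge on each of its legs, in different vertical order: the
horizontal edge of H may be tilted either way. -/
lemma split_merge_left (i m n : ℕ) (hi : i + 2 ≤ m := by omega) (hn : n = m + 1 := by omega) :
    el .split (i + 1) m n ≫ el .merge i n m = el .split i m n ≫ el .merge (i + 1) n m := by
  rw [← cup_merge_right (i + 1) m (m + 2) n (by omega) rfl hn,
    ← cup_merge_left i m (m + 2) n (by omega) rfl hn, Category.assoc, Category.assoc,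
    exch .merge .merge i (i + 2) (m + 2) n n m (i + 1)]

/-- Both sides are a split of the middle strand whose two legs are capped off against the
neighbours, in either order. -/
lemma merge_cap (i m n p : ℕ) (hi : i + 3 ≤ m := by omega) (hn : n + 1 = m := by omega)
    (hp : p + 2 = n := by omega) :
    el .merge (i + 1) m n ≫ el .cap i n p = el .merge i m n ≫ el .cap i n p := by
  rw [← split_cap_right (i + 1) m (m + 1) n, ← split_cap_left i m (m + 1) n, Category.assoc,
    Category.assoc, exch .cap .cap i (i + 2) (m + 1) n n p i]

lemma cup_split (i m n p : ℕ) (hi : i ≤ m := by omega) (hn : n = m + 2 := by omega)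
    (hp : p = n + 1 := by omega) :
    el .cup i m n ≫ el .split (i + 1) n p = el .cup i m n ≫ el .split i n p := by
  rw [← cup_merge_right i n (n + 2) p (by omega) rfl hp,
    ← cup_merge_left (i + 1) n (n + 2) p (by omega) rfl hp, ← Category.assoc, ← Category.assoc,
    exch .cup .cup i i m n n (n + 2) (i + 2)]

/-- The upside-down lollipop, reduced to the imposed one by moving the merge to the other leg of the
cap. -/
lemma split_cap_self (i m n p : ℕ) (hi : i + 1 ≤ m := by omega) (hn : n = m + 1 := by omega)
    (hp : p + 1 = m := by omega) :
    el .split i m n ≫ el .cap i n p = 0 := by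
  rw [← cup_merge_left i m (m + 2) n (by omega) rfl hn, Category.assoc, ← merge_cap i (m + 2) n p,
    ← Category.assoc, cup_merge_self (i + 1) m (m + 2) n (by omega) rfl hn, Limits.zero_comp]

/-! ## The algebra on two strands -/

lemma I_sq : I₂ ≫ I₂ = bigonValue • I₂ := by
  rw [I₂, Category.assoc, ← Category.assoc (el .split 0 1 2), split_merge_self 0 1 2 le_rfl rfl,
    Linear.smul_comp, Linear.comp_smul, Category.id_comp]

lemma I_U : I₂ ≫ U₂ = 0 := by
  rw [I₂, U₂, Category.assoc, ← Category.assoc (el .split 0 1 2)]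
  rw [show el .split 0 1 2 ≫ el .cap 0 2 0 = 0 from split_cap_self 0 1 2 0]
  simp

lemma U_I : U₂ ≫ I₂ = 0 := by
  rw [I₂, U₂, Category.assoc, ← Category.assoc (el .cup 0 0 2),
    cup_merge_self 0 0 2 1 le_rfl rfl rfl]
  simp

lemma U_sq : U₂ ≫ U₂ = loopValue • U₂ := by
  rw [U₂, Category.assoc, ← Category.assoc (el .cup 0 0 2), cup_cap_self 0 0 2 le_rfl rfl,
    Linear.smul_comp, Linear.comp_smul, Category.id_comp]

lemma H_merge : H₂ ≫ el .merge 0 2 1 = triangleValue • el .merge 0 2 1 := by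
  rw [H₂, Category.assoc, triangle_rel]

lemma H_eq : el .split 1 2 3 ≫ el .merge 0 3 2 = H₂ := split_merge_left 0 2 3

lemma H_cap : H₂ ≫ el .cap 0 2 0 = bigonValue • el .cap 0 2 0 := by
  rw [H₂, Category.assoc, merge_cap 0 3 2 0, ← Category.assoc,
    split_merge_self 0 2 3 (by omega) rfl, Linear.smul_comp, Category.id_comp]

lemma cup_H : el .cup 0 0 2 ≫ H₂ = bigonValue • el .cup 0 0 2 := by
  rw [H₂, ← Category.assoc, ← cup_split 0 0 2 3, Category.assoc,
    split_merge_self 1 2 3 (by omega) rfl, Linear.comp_smul, Category.comp_id]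

/-- The triangle relation is imposed with a merge at the top; bending a bottom leg upwards with a
cup gives this rotated form. -/
lemma split_H : el .split 0 1 2 ≫ H₂ = triangleValue • el .split 0 1 2 := by
  have h1 : el .cup 1 1 3 ≫ el .split 0 3 4 ≫ el .merge 1 4 3 ≫ el .merge 0 3 2
      = triangleValue • (el .cup 1 1 3 ≫ el .merge 0 3 2) := by
    have e := congrArg (jux 0 1) triangle_rel
    rw [jux_smul, jux_comp, jux_comp, jux_el _ _ _ _ _ _ (by decide) (by decide),
      jux_el _ _ _ _ _ _ (by decide) (by decide), jux_el _ _ _ _ _ _ (by decide) (by decide)] at e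
    rw [← Linear.comp_smul]
    exact congrArg (el .cup 1 1 3 ≫ ·) e
  rw [cup_merge_left 0 1 3 2 le_rfl rfl rfl] at h1
  rw [← h1, ← H_eq, ← Category.assoc (el .cup 1 1 3), ← exch .split .cup 0 1 1 2 3 4 2,
    ← cup_merge_left 1 2 4 3 (by omega) rfl rfl]
  simp only [Category.assoc]

lemma I_H : I₂ ≫ H₂ = triangleValue • I₂ := by
  rw [I₂, Category.assoc, split_H, Linear.comp_smul]

lemma H_I : H₂ ≫ I₂ = triangleValue • I₂ := by
  rw [I₂, ← Category.assoc, H_merge, Linear.smul_comp]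

lemma H_U : H₂ ≫ U₂ = bigonValue • U₂ := by
  rw [U₂, ← Category.assoc, H_cap, Linear.smul_comp]

lemma U_H : U₂ ≫ H₂ = bigonValue • U₂ := by
  rw [U₂, Category.assoc, cup_H, Linear.comp_smul]

/-! ## Coefficients -/

instance natAlgebraCoeff : Algebra ℕ Coeff := Semiring.toNatAlgebra

instance intAlgebraCoeff : Algebra ℤ Coeff := Ring.toIntAlgebra Coeff

/-- Non-vanishing of a coefficient is certified by evaluating a polynomial at one complex number. -/
lemma algebraMap_ne_zero_of_eval (p : Polynomial ℂ) (z : ℂ) {x : Coeff}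
    (hx : algebraMap (Polynomial ℂ) Coeff p = x) (h : p.eval z ≠ 0) : x ≠ 0 := by
  rw [← hx]
  refine RatFunc.algebraMap_ne_zero ?_
  rintro rfl
  simp at h

lemma q_ne_zero : q ≠ 0 := RatFunc.X_ne_zero

lemma one_add_q_sq_ne_zero : 1 + q ^ 2 ≠ 0 := by
  exact algebraMap_ne_zero_of_eval (1 + .X ^ 2) 1 (by simp [q]) (by norm_num)

lemma one_add_inv_q_sq_ne_zero : 1 + q⁻¹ ^ 2 ≠ 0 := by
  have := q_ne_zero
  have h : 1 + q⁻¹ ^ 2 = (1 + q ^ 2) / q ^ 2 := by field_simp; ring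
  rw [h]
  exact div_ne_zero one_add_q_sq_ne_zero (pow_ne_zero _ q_ne_zero)

lemma loopValue_ne_zero : loopValue ≠ 0 := by
  have := q_ne_zero
  have h : loopValue = (q ^ 20 + q ^ 18 + q ^ 12 + q ^ 10 + q ^ 8 + q ^ 2 + 1) / q ^ 10 := by
    rw [loopValue]; field_simp
  rw [h]
  refine div_ne_zero ?_ (pow_ne_zero _ q_ne_zero)
  exact algebraMap_ne_zero_of_eval
    (.X ^ 20 + .X ^ 18 + .X ^ 12 + .X ^ 10 + .X ^ 8 + .X ^ 2 + 1) 1 (by simp [q]) (by norm_num)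

lemma bigonValue_ne_zero : bigonValue ≠ 0 := by
  have := q_ne_zero
  have h : bigonValue = -((q ^ 12 + q ^ 10 + q ^ 8 + q ^ 4 + q ^ 2 + 1) / q ^ 6) := by
    rw [bigonValue]; field_simp
  rw [h, neg_ne_zero]
  refine div_ne_zero ?_ (pow_ne_zero _ q_ne_zero)
  exact algebraMap_ne_zero_of_eval
    (.X ^ 12 + .X ^ 10 + .X ^ 8 + .X ^ 4 + .X ^ 2 + 1) 1 (by simp [q]) (by norm_num)

lemma squareValue_ne_zero : q ^ 2 + 1 + q⁻¹ ^ 2 ≠ 0 := by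
  have := q_ne_zero
  have h : q ^ 2 + 1 + q⁻¹ ^ 2 = (q ^ 4 + q ^ 2 + 1) / q ^ 2 := by field_simp
  rw [h]
  refine div_ne_zero ?_ (pow_ne_zero _ q_ne_zero)
  exact algebraMap_ne_zero_of_eval (.X ^ 4 + .X ^ 2 + 1) 1 (by simp [q]) (by norm_num)

/-! ## The crossing and its inverse -/

/-- A linear combination of the four basis diagrams on two strands. -/
def comb (a b c d : Coeff) : ob 2 ⟶ ob 2 := a • I₂ + b • H₂ + c • U₂ + d • 𝟙 (ob 2)

lemma comb_comp (a b c d a' b' c' d' : Coeff) : comb a b c d ≫ comb a' b' c' d' =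
    comb (a * a' * bigonValue + triangleValue * (a * b' + b * a') + a * d' + d * a'
        - (q ^ 2 + q⁻¹ ^ 2) * b * b')
      (b * d' + d * b' - (q ^ 2 + q⁻¹ ^ 2) * b * b')
      (loopValue * c * c' + bigonValue * (b * c' + c * b') + c * d' + d * c'
        + (q ^ 2 + 1 + q⁻¹ ^ 2) * b * b')
      (d * d' + (q ^ 2 + 1 + q⁻¹ ^ 2) * b * b') := by
  simp only [comb, Preadditive.comp_add, Preadditive.add_comp, Linear.smul_comp, Linear.comp_smul,
    I_sq, I_H, I_U, H_I, H_U, U_I, U_H, U_sq, square_rel, Category.id_comp, Category.comp_id]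
  module

/-- The crossing of two strands. -/
def cross : ob 2 ⟶ ob 2 :=
  comb (1 + q ^ 2)⁻¹ (1 + q⁻¹ ^ 2)⁻¹ (q ^ 2 + q ^ 4)⁻¹ (q⁻¹ ^ 2 + q⁻¹ ^ 4)⁻¹

/-- The inverse crossing of two strands. -/
def crossInv : ob 2 ⟶ ob 2 :=
  comb (1 + q⁻¹ ^ 2)⁻¹ (1 + q ^ 2)⁻¹ (q⁻¹ ^ 2 + q⁻¹ ^ 4)⁻¹ (q ^ 2 + q ^ 4)⁻¹

lemma coeff_b : (1 + q⁻¹ ^ 2)⁻¹ = q ^ 2 / (1 + q ^ 2) := by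
  have := q_ne_zero
  have := one_add_q_sq_ne_zero
  rw [show 1 + q⁻¹ ^ 2 = (1 + q ^ 2) / q ^ 2 by field_simp; ring, inv_div]

lemma coeff_c : (q ^ 2 + q ^ 4)⁻¹ = 1 / (q ^ 2 * (1 + q ^ 2)) := by
  rw [show q ^ 2 + q ^ 4 = q ^ 2 * (1 + q ^ 2) by ring, one_div]

lemma coeff_d : (q⁻¹ ^ 2 + q⁻¹ ^ 4)⁻¹ = q ^ 4 / (1 + q ^ 2) := by
  have := q_ne_zero
  rw [show q⁻¹ ^ 2 + q⁻¹ ^ 4 = (1 + q ^ 2) / q ^ 4 by field_simp; ring, inv_div]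

lemma one_eq_comb : 𝟙 (ob 2) = comb 0 0 0 1 := by simp [comb]

lemma cross_comp_crossInv : cross ≫ crossInv = 𝟙 (ob 2) := by
  have := q_ne_zero
  have := one_add_q_sq_ne_zero
  rw [cross, crossInv, comb_comp, one_eq_comb, coeff_b, coeff_c, coeff_d, bigonValue, loopValue,
    triangleValue]
  congr 1 <;> field_simp <;> ring

/-- The formula in `comb_comp` is symmetric in its two factors, so the four diagrams span a
commutative algebra. -/
lemma crossInv_comp_cross : crossInv ≫ cross = 𝟙 (ob 2) := by
  rw [← cross_comp_crossInv, cross, crossInv, comb_comp, comb_comp]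
  congr 1 <;> ring

/-- I and U span an ideal of the two-strand algebra, and modulo this ideal the crossing has
eigenvalues q² and −1. -/
lemma cross_quadratic : (cross - q ^ 2 • 𝟙 (ob 2)) ≫ (cross + 𝟙 (ob 2))
    = ((1 + q⁻¹ ^ 2) * (1 - q⁻¹ ^ 4) / (1 + q ^ 2) ^ 2) • I₂
      + ((1 + q⁻¹ ^ 2) * (q⁻¹ ^ 12 - q⁻¹ ^ 4) / (1 + q ^ 2) ^ 2) • U₂ := by
  have := q_ne_zero
  have := one_add_q_sq_ne_zero
  have h1 : cross - q ^ 2 • 𝟙 (ob 2) = comb (1 + q ^ 2)⁻¹ (1 + q⁻¹ ^ 2)⁻¹ (q ^ 2 + q ^ 4)⁻¹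
      ((q⁻¹ ^ 2 + q⁻¹ ^ 4)⁻¹ - q ^ 2) := by
    rw [cross, comb, comb]; module
  have h2 : cross + 𝟙 (ob 2) = comb (1 + q ^ 2)⁻¹ (1 + q⁻¹ ^ 2)⁻¹ (q ^ 2 + q ^ 4)⁻¹
      ((q⁻¹ ^ 2 + q⁻¹ ^ 4)⁻¹ + 1) := by
    rw [cross, comb, comb]; module
  have h3 (x y : Coeff) : x • I₂ + y • U₂ = comb x 0 y 0 := by
    rw [comb]; module
  rw [h1, h2, h3, comb_comp, coeff_b, coeff_c, coeff_d, bigonValue, loopValue, triangleValue]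
  congr 1 <;> field_simp <;> ring

/-- The crossing acts on I by −q⁻⁶, so the third factor kills I; it acts on U by q⁻¹², whence the
factor q⁻¹² + q⁻⁶. -/
lemma cross_cubic : (cross - q ^ 2 • 𝟙 (ob 2)) ≫ (cross + 𝟙 (ob 2))
      ≫ (cross + q⁻¹ ^ 6 • 𝟙 (ob 2))
    = ((1 + q⁻¹ ^ 2) * (q⁻¹ ^ 12 - q⁻¹ ^ 4) * (q⁻¹ ^ 12 + q⁻¹ ^ 6) / (1 + q ^ 2) ^ 2) • U₂ := by
  have := q_ne_zero
  have := one_add_q_sq_ne_zero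
  have h2 : cross + q⁻¹ ^ 6 • 𝟙 (ob 2) = comb (1 + q ^ 2)⁻¹ (1 + q⁻¹ ^ 2)⁻¹ (q ^ 2 + q ^ 4)⁻¹
      ((q⁻¹ ^ 2 + q⁻¹ ^ 4)⁻¹ + q⁻¹ ^ 6) := by
    rw [cross, comb, comb]; module
  have h3 (x y : Coeff) : x • I₂ + y • U₂ = comb x 0 y 0 := by
    rw [comb]; module
  have h4 (y : Coeff) : y • U₂ = comb 0 0 y 0 := by
    rw [comb]; module
  rw [← Category.assoc, cross_quadratic, h2, h3, h4, comb_comp, coeff_b, coeff_c, coeff_d,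
    bigonValue, loopValue, triangleValue]
  congr 1 <;> field_simp <;> ring

lemma coeff_I_ne_zero : (1 + q⁻¹ ^ 2) * (1 - q⁻¹ ^ 4) / (1 + q ^ 2) ^ 2 ≠ 0 := by
  have := q_ne_zero
  refine div_ne_zero (mul_ne_zero one_add_inv_q_sq_ne_zero ?_)
    (pow_ne_zero _ one_add_q_sq_ne_zero)
  rw [show 1 - q⁻¹ ^ 4 = (q ^ 4 - 1) / q ^ 4 by field_simp]
  refine div_ne_zero ?_ (pow_ne_zero _ this)
  -- The polynomial vanishes at 1, so the evaluation point is 2.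
  exact algebraMap_ne_zero_of_eval (.X ^ 4 - 1) 2 (by simp [q]) (by norm_num)

lemma coeff_U_ne_zero :
    (1 + q⁻¹ ^ 2) * (q⁻¹ ^ 12 - q⁻¹ ^ 4) * (q⁻¹ ^ 12 + q⁻¹ ^ 6) / (1 + q ^ 2) ^ 2 ≠ 0 := by
  have := q_ne_zero
  refine div_ne_zero (mul_ne_zero (mul_ne_zero one_add_inv_q_sq_ne_zero ?_) ?_)
    (pow_ne_zero _ one_add_q_sq_ne_zero)
  · rw [show q⁻¹ ^ 12 - q⁻¹ ^ 4 = (1 - q ^ 8) / q ^ 12 by field_simp]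
    refine div_ne_zero ?_ (pow_ne_zero _ this)
    exact algebraMap_ne_zero_of_eval (1 - .X ^ 8) 2 (by simp [q]) (by norm_num)
  · rw [show q⁻¹ ^ 12 + q⁻¹ ^ 6 = (1 + q ^ 6) / q ^ 12 by field_simp]
    refine div_ne_zero ?_ (pow_ne_zero _ this)
    exact algebraMap_ne_zero_of_eval (1 + .X ^ 6) 2 (by simp [q]) (by norm_num)

/-! ## Placing a morphism between vertical strands -/

/-- The morphism `f` with `i` strands on its left, as a morphism from `m` to `n` points. It is `0`
when the numbers do not fit. -/
def place (i m n : ℕ) {k l : ℕ} (f : ob k ⟶ ob l) : ob m ⟶ ob n :=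
  if h : i + k ≤ m ∧ n + k = m + l then
    eqToHom (congrArg ob (show m = i + k + (m - k - i) by omega)) ≫ jux i (m - k - i) f ≫
      eqToHom (congrArg ob (show i + l + (m - k - i) = n by omega))
  else 0

lemma place_eq_jux (i r : ℕ) {k l : ℕ} (f : ob k ⟶ ob l) :
    place i (i + k + r) (i + l + r) f = jux i r f := by
  -- The padding is generalised to `s`: in the definition it is a truncated difference, and the
  -- transports disappear only once it is identified with `r`.
  have key (s : ℕ) (hs : s = r) :
      eqToHom (congrArg ob (show i + k + r = i + k + s by omega)) ≫ jux i s f ≫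
        eqToHom (congrArg ob (show i + l + s = i + l + r by omega)) = jux i r f := by
    subst hs
    simp
  rw [place, dif_pos (by omega)]
  exact key _ (by omega)

section place

variable (i m n p : ℕ) {k l j : ℕ}

lemma place_of_fits (h : i + k ≤ m) (h' : n + k = m + l) :
    ∃ r, m = i + k + r ∧ n = i + l + r := ⟨m - k - i, by omega, by omega⟩

lemma place_add (f g : ob k ⟶ ob l) (h : i + k ≤ m := by omega) (h' : n + k = m + l := by omega) :
    place i m n (f + g) = place i m n f + place i m n g := by
  obtain ⟨r, rfl, rfl⟩ := place_of_fits i m n h h'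
  simp only [place_eq_jux, jux_add]

lemma place_smul (c : Coeff) (f : ob k ⟶ ob l) (h : i + k ≤ m := by omega)
    (h' : n + k = m + l := by omega) :
    place i m n (c • f) = c • place i m n f := by
  obtain ⟨r, rfl, rfl⟩ := place_of_fits i m n h h'
  simp only [place_eq_jux, jux_smul]

lemma place_comp (f : ob k ⟶ ob l) (g : ob l ⟶ ob j) (h : i + k ≤ m)
    (h' : n + k = m + l) (h'' : p + l = n + j) :
    place i m p (f ≫ g) = place i m n f ≫ place i n p g := by
  obtain ⟨r, rfl, rfl⟩ := place_of_fits i m n h h'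
  obtain rfl : p = i + j + r := by omega
  simp only [place_eq_jux, jux_comp]

lemma place_id (h : i + k ≤ m := by omega) : place i m m (𝟙 (ob k)) = 𝟙 (ob m) := by
  obtain ⟨r, rfl, -⟩ := place_of_fits i m m h rfl
  simp only [place_eq_jux, jux_id]

lemma place_el (g : Piece) (a : ℕ) (h : i + k ≤ m) (h' : n + k = m + l)
    (ha : a + g.src ≤ k)
    (hl : l + g.src = k + g.tgt) :
    place i m n (el g a k l) = el g (i + a) m n := by
  obtain ⟨r, rfl, rfl⟩ := place_of_fits i m n h h'
  rw [place_eq_jux, jux_el i r g a k l ha hl]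

end place

lemma place_I (i n : ℕ) (h : i + 2 ≤ n := by omega) :
    place i n n I₂ = el .merge i n (n - 1) ≫ el .split i (n - 1) n := by
  rw [I₂, place_comp i n (n - 1) n _ _ (by omega) (by omega) (by omega),
    place_el i n (n - 1) _ _ (by omega) (by omega) (by decide) (by decide),
    place_el i (n - 1) n _ _ (by omega) (by omega) (by decide) (by decide)]
  rfl

lemma place_H (i n : ℕ) (h : i + 2 ≤ n := by omega) :
    place i n n H₂ = el .split i n (n + 1) ≫ el .merge (i + 1) (n + 1) n := by
  rw [H₂, place_comp i n (n + 1) n _ _ (by omega) (by omega) (by omega),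
    place_el i n (n + 1) _ _ (by omega) (by omega) (by decide) (by decide),
    place_el i (n + 1) n _ _ (by omega) (by omega) (by decide) (by decide)]
  rfl

lemma place_U (i n : ℕ) (h : i + 2 ≤ n := by omega) :
    place i n n U₂ = el .cap i n (n - 2) ≫ el .cup i (n - 2) n := by
  rw [U₂, place_comp i n (n - 2) n _ _ (by omega) (by omega) (by omega),
    place_el i n (n - 2) _ _ (by omega) (by omega) (by decide) (by decide),
    place_el i (n - 2) n _ _ (by omega) (by omega) (by decide) (by decide)]
  rfl

lemma place_comb (i n : ℕ) (a b c d : Coeff) (h : i + 2 ≤ n := by omega) :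
    place i n n (comb a b c d)
      = a • place i n n I₂ + b • place i n n H₂ + c • place i n n U₂ + d • 𝟙 (ob n) := by
  rw [comb, place_add i n n _ _ h rfl, place_add i n n _ _ h rfl, place_add i n n _ _ h rfl,
    place_smul i n n _ _ h rfl, place_smul i n n _ _ h rfl, place_smul i n n _ _ h rfl,
    place_smul i n n _ _ h rfl, place_id i n h]

lemma crossing_eq_place (n : ℕ) (i : Fin (n - 1)) : crossing n i = place i n n cross := by
  have h : (i : ℕ) + 2 ≤ n := by omega
  rw [cross, place_comb i n _ _ _ _ h, place_I i n h, place_H i n h, place_U i n h, crossing,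
    toSpider_webI, toSpider_webH, toSpider_webCapCup, toSpider_id]

/-! ## Local relations in every width -/

lemma split_H_at (i m n : ℕ) (h : i + 1 ≤ m := by omega) (hn : n = m + 1 := by omega) :
    el .split i m n ≫ place i n n H₂ = triangleValue • el .split i m n := by
  have e := congrArg (place i m n) split_H
  rwa [place_smul i m n _ _ h, place_comp i m n n _ _ (by omega) (by omega) (by omega),
    place_el i m n _ _ (by omega) (by omega) (by decide) (by decide), Nat.add_zero] at e

lemma square_at (i n : ℕ) (h : i + 2 ≤ n := by omega) :
    place i n n H₂ ≫ place i n n H₂ = -(q ^ 2 + q⁻¹ ^ 2) • (place i n n I₂ + place i n n H₂)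
      + (q ^ 2 + 1 + q⁻¹ ^ 2) • (place i n n U₂ + 𝟙 (ob n)) := by
  rw [← place_comp i n n n _ _ h (by omega) (by omega), square_rel, place_add i n n _ _ h,
    place_smul i n n _ _ h,
    place_smul i n n _ _ h, place_add i n n _ _ h, place_add i n n _ _ h, place_id i n h]

/-! ## Sliding a strand across a vertex -/

/-! ### Products of a split with diagrams on the right (R) and left (L) pair of three strands -/

section table

lemma split_IL : el .split 0 2 3 ≫ place 0 3 3 I₂ = bigonValue • el .split 0 2 3 := by
  rw [place_I 0 3, ← Category.assoc, split_merge_self 0 2 3 (by omega) rfl, Linear.smul_comp,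
    Category.id_comp]

lemma split_UL : el .split 0 2 3 ≫ place 0 3 3 U₂ = 0 := by
  rw [place_U 0 3, ← Category.assoc, split_cap_self 0 2 3 (3 - 2), Limits.zero_comp]

lemma split_UR : el .split 0 2 3 ≫ place 1 3 3 U₂ = el .merge 0 2 1 ≫ el .cup 1 1 3 := by
  rw [place_U 1 3, ← Category.assoc, split_cap_right 0 2 3 (3 - 2)]

lemma split_IR : el .split 0 2 3 ≫ place 1 3 3 I₂ = H₂ ≫ el .split 1 2 3 := by
  rw [place_I 1 3, H₂, Category.assoc]

lemma split_HR : el .split 0 2 3 ≫ place 1 3 3 H₂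
    = el .split 0 2 3 ≫ el .split 2 3 4 ≫ el .merge 1 4 3 := by
  rw [place_H 1 3, split_merge_left 1 3 4]

lemma cup_IL : el .cup 1 1 3 ≫ place 0 3 3 I₂ = el .split 0 1 2 ≫ el .split 0 2 3 := by
  rw [place_I 0 3, ← Category.assoc, cup_merge_left 0 1 3 (3 - 1) le_rfl rfl rfl]

lemma cup_HL : el .cup 1 1 3 ≫ place 0 3 3 H₂ = el .split 0 1 2 ≫ el .split 1 2 3 := by
  rw [place_H 0 3, ← Category.assoc, ← exch .split .cup 0 1 1 2 3 (3 + 1) 2, Category.assoc,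
    cup_merge_left 1 2 (3 + 1) 3 (by omega) rfl rfl]

lemma cup_UL : el .cup 1 1 3 ≫ place 0 3 3 U₂ = el .cup 0 1 3 := by
  rw [place_U 0 3, ← Category.assoc, cup_cap_left 0 1 3 le_rfl rfl, Category.id_comp]

lemma splitR_IL : el .split 1 2 3 ≫ place 0 3 3 I₂ = H₂ ≫ el .split 0 2 3 := by
  rw [place_I 0 3, ← Category.assoc]
  exact congrArg (· ≫ el .split 0 2 3) H_eq

lemma splitR_HL : el .split 1 2 3 ≫ place 0 3 3 H₂
    = el .split 0 2 3 ≫ el .split 2 3 4 ≫ el .merge 1 4 3 := by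
  rw [place_H 0 3, ← Category.assoc, ← Category.assoc,
    exch .split .split 0 1 2 3 3 (3 + 1) 2]

lemma splitR_UL : el .split 1 2 3 ≫ place 0 3 3 U₂ = el .merge 0 2 1 ≫ el .cup 0 1 3 := by
  rw [place_U 0 3, ← Category.assoc, split_cap_left 0 2 3 (3 - 2)]

lemma HsplitR_IL : (H₂ ≫ el .split 1 2 3) ≫ place 0 3 3 I₂
    = -(q ^ 2 + q⁻¹ ^ 2) • (I₂ ≫ el .split 0 2 3 + H₂ ≫ el .split 0 2 3)
      + (q ^ 2 + 1 + q⁻¹ ^ 2) • (U₂ ≫ el .split 1 2 3 + el .split 0 2 3) := by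
  have h : U₂ ≫ el .split 0 2 3 = U₂ ≫ el .split 1 2 3 := by
    rw [U₂, Category.assoc, Category.assoc, cup_split 0 0 2 3]
  rw [Category.assoc, splitR_IL, ← Category.assoc, square_rel, Preadditive.add_comp,
    Linear.smul_comp, Linear.smul_comp, Preadditive.add_comp, Preadditive.add_comp,
    Category.id_comp, h]

lemma HsplitR_UL : (H₂ ≫ el .split 1 2 3) ≫ place 0 3 3 U₂
    = triangleValue • (el .merge 0 2 1 ≫ el .cup 0 1 3) := by
  rw [Category.assoc, splitR_UL, ← Category.assoc, H_merge, Linear.smul_comp]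

/-- Read as a right split followed by H on the left pair, the tree reduces these products to the
multiplication table on two strands. -/
lemma tree_IL : (el .split 0 2 3 ≫ el .split 2 3 4 ≫ el .merge 1 4 3) ≫ place 0 3 3 I₂
    = triangleValue • (H₂ ≫ el .split 0 2 3) := by
  rw [← splitR_HL, Category.assoc, ← splitR_IL, ← Linear.comp_smul]
  congr 1
  rw [← place_comp 0 3 3 3 _ _ (by omega) (by omega) (by omega), H_I, place_smul 0 3 3]

lemma tree_UL : (el .split 0 2 3 ≫ el .split 2 3 4 ≫ el .merge 1 4 3) ≫ place 0 3 3 U₂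
    = bigonValue • (el .merge 0 2 1 ≫ el .cup 0 1 3) := by
  rw [← splitR_HL, Category.assoc, ← splitR_UL, ← Linear.comp_smul]
  congr 1
  rw [← place_comp 0 3 3 3 _ _ (by omega) (by omega) (by omega), H_U, place_smul 0 3 3]

lemma tree_HL : (el .split 0 2 3 ≫ el .split 2 3 4 ≫ el .merge 1 4 3) ≫ place 0 3 3 H₂
    = -(q ^ 2 + q⁻¹ ^ 2) • (H₂ ≫ el .split 0 2 3
        + el .split 0 2 3 ≫ el .split 2 3 4 ≫ el .merge 1 4 3)
      + (q ^ 2 + 1 + q⁻¹ ^ 2) • (el .merge 0 2 1 ≫ el .cup 0 1 3 + el .split 1 2 3) := by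
  rw [← splitR_HL, Category.assoc, square_at 0 3, Preadditive.comp_add, Linear.comp_smul,
    Linear.comp_smul, Preadditive.comp_add, Preadditive.comp_add, Category.comp_id, splitR_IL,
    splitR_HL, splitR_UL]

/-- The only product in the table that closes up a pentagon. -/
lemma HsplitR_HL : (H₂ ≫ el .split 1 2 3) ≫ place 0 3 3 H₂
    = (I₂ ≫ el .split 0 2 3 + I₂ ≫ el .split 1 2 3
        + el .split 0 2 3 ≫ el .split 2 3 4 ≫ el .merge 1 4 3
        + H₂ ≫ el .split 0 2 3 + H₂ ≫ el .split 1 2 3)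
      - (U₂ ≫ el .split 1 2 3 + el .split 0 2 3 + el .split 1 2 3
        + el .merge 0 2 1 ≫ el .cup 1 1 3 + el .merge 0 2 1 ≫ el .cup 0 1 3) := by
  rw [← pentagon_rel, Category.assoc, splitR_HL]

/-- Expansion in the five trees and five forests of the pentagon relation. The coefficients stay
general so that it serves the crossing and its inverse alike. -/
lemma split_comb_comb (a b c d : Coeff) :
    el .split 0 2 3 ≫ place 1 3 3 (comb a b c d) ≫ place 0 3 3 (comb a b c d)
      = (c * a - a * a * (q ^ 2 + q⁻¹ ^ 2) + a * b) • (I₂ ≫ el .split 0 2 3)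
      + (c * b + a * b) • (I₂ ≫ el .split 1 2 3)
      + (a * b - b * b * (q ^ 2 + q⁻¹ ^ 2) + b * d) •
          (el .split 0 2 3 ≫ el .split 2 3 4 ≫ el .merge 1 4 3)
      + (-(a * a * (q ^ 2 + q⁻¹ ^ 2)) + a * b + b * a * triangleValue
          - b * b * (q ^ 2 + q⁻¹ ^ 2)) • (H₂ ≫ el .split 0 2 3)
      + (a * b + a * d) • (H₂ ≫ el .split 1 2 3)
      + (a * a * (q ^ 2 + 1 + q⁻¹ ^ 2) - a * b) • (U₂ ≫ el .split 1 2 3)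
      + (d * a * bigonValue + d * b * triangleValue + d * d
          + a * a * (q ^ 2 + 1 + q⁻¹ ^ 2) - a * b) • el .split 0 2 3
      + (b * b * (q ^ 2 + 1 + q⁻¹ ^ 2) - a * b) • el .split 1 2 3
      + (c * d - a * b) • (el .merge 0 2 1 ≫ el .cup 1 1 3)
      + (c * c - a * b + a * c * triangleValue + b * b * (q ^ 2 + 1 + q⁻¹ ^ 2)
          + b * c * bigonValue) • (el .merge 0 2 1 ≫ el .cup 0 1 3) := by
  have h1 : I₂ ≫ el .split 0 2 3 = el .merge 0 2 1 ≫ el .split 0 1 2 ≫ el .split 0 2 3 := by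
    rw [I₂, Category.assoc]
  have h2 : I₂ ≫ el .split 1 2 3 = el .merge 0 2 1 ≫ el .split 0 1 2 ≫ el .split 1 2 3 := by
    rw [I₂, Category.assoc]
  rw [← Category.assoc, place_comb 1 3, place_comb 0 3]
  simp only [Preadditive.comp_add, Preadditive.add_comp, Linear.comp_smul, Linear.smul_comp,
    Category.comp_id, split_IL, split_UL, split_UR, split_IR, split_HR, split_H_at 0 2 3,
    HsplitR_IL, HsplitR_HL, HsplitR_UL, tree_IL, tree_HL, tree_UL]
  simp only [Category.assoc (el .merge 0 2 1), cup_IL, cup_HL, cup_UL, ← h1, ← h2]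
  module

end table

/-- A strand moves across a split. Of the ten coefficients on the left, six vanish and the other
four match those of the crossing followed by the right split. -/
lemma split_cross : el .split 0 2 3 ≫ place 1 3 3 cross ≫ place 0 3 3 cross
    = cross ≫ el .split 1 2 3 := by
  have := q_ne_zero
  have := one_add_q_sq_ne_zero
  rw [cross, split_comb_comb, comb, Preadditive.add_comp, Preadditive.add_comp,
    Preadditive.add_comp, Linear.smul_comp, Linear.smul_comp, Linear.smul_comp, Linear.smul_comp,
    Category.id_comp, coeff_b, coeff_c, coeff_d, bigonValue, triangleValue]
  match_scalars <;> field_simp <;> ring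

lemma split_crossInv : el .split 0 2 3 ≫ place 1 3 3 crossInv ≫ place 0 3 3 crossInv
    = crossInv ≫ el .split 1 2 3 := by
  have := q_ne_zero
  have := one_add_q_sq_ne_zero
  rw [crossInv, split_comb_comb, comb, Preadditive.add_comp, Preadditive.add_comp,
    Preadditive.add_comp, Linear.smul_comp, Linear.smul_comp, Linear.smul_comp, Linear.smul_comp,
    Category.id_comp, coeff_b, coeff_c, coeff_d, bigonValue, triangleValue]
  match_scalars <;> field_simp <;> ring

/-! ## Distant pieces commute -/

lemma piece_counts : Piece.cup.src = 0 ∧ Piece.cap.src = 2 ∧ Piece.merge.src = 2 ∧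
    Piece.split.src = 1 ∧ Piece.cup.tgt = 2 ∧ Piece.cap.tgt = 0 ∧ Piece.merge.tgt = 1 ∧
    Piece.split.tgt = 2 := ⟨rfl, rfl, rfl, rfl, rfl, rfl, rfl, rfl⟩

lemma el_el_comm_right (a b g : Piece) (i i' j m n p p' j' : ℕ) (hi : i + a.src ≤ j)
    (hj : j + g.src ≤ m) (hj' : j' + a.src = j + a.tgt) (hi' : i' + b.src ≤ j')
    (hn : n + g.src = m + g.tgt) (hp : p + a.src = m + a.tgt) (hp' : p' + a.src = n + a.tgt)
    (hb : m + b.src = p + b.tgt) :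
    (el a i m p ≫ el b i' p m) ≫ el g j m n = el g j m n ≫ el a i n p' ≫ el b i' p' n := by
  rw [Category.assoc, el_exchange b g i' j' p m p' n j hi' (by omega) (by omega) hb (by omega) hn,
    ← Category.assoc, el_exchange a g i j m p n p' j' hi hj hj' hp hn (by omega), Category.assoc]

lemma el_el_comm_left (a b g : Piece) (i i' j m n p p' k k' : ℕ) (hj : j + g.src ≤ i)
    (hi : i + a.src ≤ m) (hj' : j + g.src ≤ i') (hi' : i' + b.src ≤ p) (hk : k + g.src = i + g.tgt)
    (hk' : k' + g.src = i' + g.tgt)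
    (hn : n + g.src = m + g.tgt) (hp : p + a.src = m + a.tgt) (hp' : p' + a.src = n + a.tgt)
    (hb : m + b.src = p + b.tgt) :
    el g j m n ≫ el a k n p' ≫ el b k' p' n = (el a i m p ≫ el b i' p m) ≫ el g j m n := by
  rw [← Category.assoc, el_exchange g a j i m n p p' k hj hi hk hn hp hp', Category.assoc,
    el_exchange g b j i' p p' m n k' hj' hi' hk' (by omega) hb (by omega), Category.assoc]

lemma comb_el (g : Piece) (a b c d : Coeff) (i j m n : ℕ) (hi : i + 2 ≤ j)
    (hj : j + g.src ≤ m) (hn : n + g.src = m + g.tgt) :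
    place i m m (comb a b c d) ≫ el g j m n = el g j m n ≫ place i n n (comb a b c d) := by
  have := piece_counts
  rw [place_comb i m, place_comb i n, place_I i m, place_I i n, place_H i m, place_H i n,
    place_U i m, place_U i n]
  simp only [Preadditive.comp_add, Preadditive.add_comp, Linear.comp_smul, Linear.smul_comp,
    Category.comp_id, Category.id_comp]
  rw [el_el_comm_right .merge .split g i i j m n (m - 1) (n - 1) (j - 1),
    el_el_comm_right .split .merge g i (i + 1) j m n (m + 1) (n + 1) (j + 1),
    el_el_comm_right .cap .cup g i i j m n (m - 2) (n - 2) (j - 2)]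
  all_goals omega

lemma el_comb (g : Piece) (a b c d : Coeff) (i j k m n : ℕ) (hj : j + g.src ≤ i)
    (hi : i + 2 ≤ m) (hk : k + g.src = i + g.tgt) (hn : n + g.src = m + g.tgt) :
    el g j m n ≫ place k n n (comb a b c d) = place i m m (comb a b c d) ≫ el g j m n := by
  have := piece_counts
  rw [place_comb i m, place_comb k n, place_I i m, place_I k n, place_H i m, place_H k n,
    place_U i m, place_U k n]
  simp only [Preadditive.comp_add, Preadditive.add_comp, Linear.comp_smul, Linear.smul_comp,
    Category.comp_id, Category.id_comp]
  rw [el_el_comm_left .merge .split g i i j m n (m - 1) (n - 1) k k,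
    el_el_comm_left .split .merge g i (i + 1) j m n (m + 1) (n + 1) k (k + 1),
    el_el_comm_left .cap .cup g i i j m n (m - 2) (n - 2) k k]
  all_goals omega

/-- The right-hand factor is cut into elementary pieces, each of which slides past the left-hand
factor by `comb_el`. -/
lemma comb_comm (a b c d a' b' c' d' : Coeff) (i j n : ℕ) (hi : i + 2 ≤ j) (hj : j + 2 ≤ n) :
    place i n n (comb a b c d) ≫ place j n n (comb a' b' c' d')
      = place j n n (comb a' b' c' d') ≫ place i n n (comb a b c d) := by
  have := piece_counts
  rw [place_comb j n, place_I j n, place_H j n, place_U j n]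
  simp only [Preadditive.comp_add, Preadditive.add_comp, Linear.comp_smul, Linear.smul_comp,
    Category.comp_id, Category.id_comp, Category.assoc]
  rw [← Category.assoc _ (el .merge j n (n - 1)), comb_el .merge a b c d i j n (n - 1),
    ← Category.assoc _ (el .split j n (n + 1)), comb_el .split a b c d i j n (n + 1),
    ← Category.assoc _ (el .cap j n (n - 2)), comb_el .cap a b c d i j n (n - 2),
    Category.assoc, Category.assoc, Category.assoc,
    comb_el .split a b c d i j (n - 1) n, comb_el .merge a b c d i (j + 1) (n + 1) n,
    comb_el .cup a b c d i j (n - 2) n]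
  all_goals omega

lemma place_place_comb (i j l n : ℕ) (a b c d : Coeff) (hj : j + 2 ≤ l := by omega)
    (hl : i + l ≤ n := by omega) :
    place i n n (place j l l (comb a b c d)) = place (i + j) n n (comb a b c d) := by
  rw [place_comb j l, place_comb (i + j) n, place_I j l, place_H j l, place_U j l,
    place_I (i + j) n, place_H (i + j) n, place_U (i + j) n]
  rw [place_add i n n _ _ hl, place_add i n n _ _ hl, place_add i n n _ _ hl,
    place_smul i n n _ _ hl, place_smul i n n _ _ hl, place_smul i n n _ _ hl,
    place_smul i n n _ _ hl, place_id i n hl,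
    place_comp i n (n - 1) n _ _ (by omega) (by omega) (by omega),
    place_comp i n (n + 1) n _ _ (by omega) (by omega) (by omega),
    place_comp i n (n - 2) n _ _ (by omega) (by omega) (by omega)]
  have := piece_counts
  rw [place_el, place_el, place_el, place_el, place_el, place_el]
  · rfl
  all_goals omega

/-! ## The braid relation -/

/-- The crossing of the strands `i` and `i + 1` of `n`. -/
abbrev cr (n i : ℕ) : ob n ⟶ ob n := place i n n cross

/-- The inverse crossing of the strands `i` and `i + 1` of `n`. -/
abbrev cri (n i : ℕ) : ob n ⟶ ob n := place i n n crossInv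

lemma cr_comp_cri (n i : ℕ) (h : i + 2 ≤ n := by omega) : cr n i ≫ cri n i = 𝟙 (ob n) := by
  rw [← place_comp i n n n _ _ h rfl rfl, cross_comp_crossInv, place_id i n h]

lemma cri_comp_cr (n i : ℕ) (h : i + 2 ≤ n := by omega) : cri n i ≫ cr n i = 𝟙 (ob n) := by
  rw [← place_comp i n n n _ _ h rfl rfl, crossInv_comp_cross, place_id i n h]

lemma place_cr (i j l n : ℕ) (hj : j + 2 ≤ l := by omega) (hl : i + l ≤ n := by omega) :
    place i n n (cr l j) = cr n (i + j) := place_place_comb i j l n _ _ _ _ hj hl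

lemma place_cri (i j l n : ℕ) (hj : j + 2 ≤ l := by omega) (hl : i + l ≤ n := by omega) :
    place i n n (cri l j) = cri n (i + j) := place_place_comb i j l n _ _ _ _ hj hl

lemma split_cr_at (i m n : ℕ) (h : i + 2 ≤ m := by omega) (hn : n = m + 1 := by omega) :
    el .split i m n ≫ cr n (i + 1) ≫ cr n i = cr m i ≫ el .split (i + 1) m n := by
  have e := congrArg (place i m n) split_cross
  rw [place_comp i m n n _ _ (by omega) (by omega) (by omega),
    place_comp i n n n _ _ (by omega) (by omega) (by omega),
    place_comp i m m n _ _ (by omega) (by omega) (by omega), place_cr i 1 3 n, place_cr i 0 3 n,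
    place_el i m n _ _ (by omega) (by omega) (by decide) (by decide),
    place_el i m n _ _ (by omega) (by omega) (by decide) (by decide)] at e
  exact e

lemma split_cri_at (i m n : ℕ) (h : i + 2 ≤ m := by omega) (hn : n = m + 1 := by omega) :
    el .split i m n ≫ cri n (i + 1) ≫ cri n i = cri m i ≫ el .split (i + 1) m n := by
  have e := congrArg (place i m n) split_crossInv
  rw [place_comp i m n n _ _ (by omega) (by omega) (by omega),
    place_comp i n n n _ _ (by omega) (by omega) (by omega),
    place_comp i m m n _ _ (by omega) (by omega) (by omega), place_cri i 1 3 n, place_cri i 0 3 n,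
    place_el i m n _ _ (by omega) (by omega) (by decide) (by decide),
    place_el i m n _ _ (by omega) (by omega) (by decide) (by decide)] at e
  exact e

/-- Rotating a linear combination of the four diagrams by a quarter turn. -/
lemma comb_cap (a b c d : Coeff) (i m p : ℕ) (h : i + 3 ≤ m) (hp : p + 2 = m) :
    place i m m (comb a b c d) ≫ el .cap (i + 1) m p
      = place (i + 1) m m (comb b a d c) ≫ el .cap i m p := by
  have hI : place i m m I₂ ≫ el .cap (i + 1) m p
      = place (i + 1) m m H₂ ≫ el .cap i m p := by
    rw [place_I i m, place_H (i + 1) m, Category.assoc, Category.assoc,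
      split_cap_right i (m - 1) m p, ← exch .cap .merge i (i + 2) (m + 1) (m - 1) m p i,
      ← Category.assoc, split_cap_left i m (m + 1) (m - 1)]
  have hH : place i m m H₂ ≫ el .cap (i + 1) m p
      = place (i + 1) m m I₂ ≫ el .cap i m p := by
    rw [place_H i m, place_I (i + 1) m, Category.assoc, Category.assoc,
      split_cap_left i (m - 1) m p, ← merge_cap (i + 1) (m + 1) m p,
      ← Category.assoc, exch .split .merge i (i + 1) m (m + 1) (m - 1) m (i + 1 + 1),
      Category.assoc, split_cap_right i (m - 1) m p]
  have hU : place i m m U₂ ≫ el .cap (i + 1) m p = el .cap i m p := by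
    rw [place_U i m, Category.assoc]
    obtain rfl : p = m - 2 := by omega
    rw [cup_cap_right i (m - 2) m (by omega) (by omega), Category.comp_id]
  have hU' : place (i + 1) m m U₂ ≫ el .cap i m p = el .cap (i + 1) m p := by
    rw [place_U (i + 1) m, Category.assoc]
    obtain rfl : p = m - 2 := by omega
    rw [cup_cap_left i (m - 2) m (by omega) (by omega), Category.comp_id]
  rw [place_comb i m, place_comb (i + 1) m]
  simp only [Preadditive.add_comp, Linear.smul_comp, Category.id_comp, hI, hH, hU, hU']
  abel

/-- A quarter turn makes the second crossing the inverse of the first, since `crossInv` has the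
coefficients of `cross` exchanged in pairs. -/
lemma cap_cross (i m p : ℕ) (h : i + 3 ≤ m := by omega) (hp : p + 2 = m := by omega) :
    cr m (i + 1) ≫ cr m i ≫ el .cap (i + 1) m p = el .cap i m p := by
  rw [cr, cr, cross, comb_cap _ _ _ _ i m p h hp, ← Category.assoc]
  change (cr m (i + 1) ≫ cri m (i + 1)) ≫ _ = _
  rw [cr_comp_cri m (i + 1), Category.id_comp]

lemma cap_crossInv (i m p : ℕ) (h : i + 3 ≤ m := by omega) (hp : p + 2 = m := by omega) :
    cri m (i + 1) ≫ cri m i ≫ el .cap (i + 1) m p = el .cap i m p := by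
  rw [cri, cri, crossInv, comb_cap _ _ _ _ i m p h hp, ← Category.assoc]
  change (cri m (i + 1) ≫ cr m (i + 1)) ≫ _ = _
  rw [cri_comp_cr m (i + 1), Category.id_comp]

/-- A merge is a split with a leg capped off, so the strand passes first the cap (`cap_cross`) and
then the split (`split_cr_at`). -/
lemma merge_cr_at (i m n : ℕ) (h : i + 3 ≤ m := by omega) (hn : n + 1 = m := by omega) :
    el .merge i m n ≫ cr n i = cr m (i + 1) ≫ cr m i ≫ el .merge (i + 1) m n := by
  have h1 : cr (m + 1) i ≫ el .cap (i + 1 + 1) (m + 1) n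
      = el .cap (i + 1 + 1) (m + 1) n ≫ cr n i :=
    comb_el .cap _ _ _ _ i (i + 1 + 1) (m + 1) n le_rfl (by simp only [Piece.src]; omega)
      (by simp only [Piece.src, Piece.tgt]; omega)
  have h2 : el .split i m (m + 1) ≫ cr (m + 1) (i + 1 + 1)
      = cr m (i + 1) ≫ el .split i m (m + 1) :=
    el_comb .split _ _ _ _ (i + 1) i (i + 1 + 1) m (m + 1) le_rfl (by omega) rfl rfl
  rw [← split_cap_right i m (m + 1) n, ← cap_cross (i + 1) (m + 1) n]
  simp only [Category.assoc]
  rw [← h1, ← Category.assoc, h2, Category.assoc, ← Category.assoc (cr (m + 1) (i + 1)),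
    ← Category.assoc (el .split i m (m + 1)), split_cr_at i m (m + 1), Category.assoc,
    split_cap_right (i + 1) m (m + 1) n]

lemma merge_cri_at (i m n : ℕ) (h : i + 3 ≤ m := by omega) (hn : n + 1 = m := by omega) :
    el .merge i m n ≫ cri n i = cri m (i + 1) ≫ cri m i ≫ el .merge (i + 1) m n := by
  have h1 : cri (m + 1) i ≫ el .cap (i + 1 + 1) (m + 1) n
      = el .cap (i + 1 + 1) (m + 1) n ≫ cri n i :=
    comb_el .cap _ _ _ _ i (i + 1 + 1) (m + 1) n le_rfl (by simp only [Piece.src]; omega)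
      (by simp only [Piece.src, Piece.tgt]; omega)
  have h2 : el .split i m (m + 1) ≫ cri (m + 1) (i + 1 + 1)
      = cri m (i + 1) ≫ el .split i m (m + 1) :=
    el_comb .split _ _ _ _ (i + 1) i (i + 1 + 1) m (m + 1) le_rfl (by omega) rfl rfl
  rw [← split_cap_right i m (m + 1) n, ← cap_crossInv (i + 1) (m + 1) n]
  simp only [Category.assoc]
  rw [← h1, ← Category.assoc, h2, Category.assoc, ← Category.assoc (cri (m + 1) (i + 1)),
    ← Category.assoc (el .split i m (m + 1)), split_cri_at i m (m + 1), Category.assoc,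
    split_cap_right (i + 1) m (m + 1) n]

/-- Moving inverse crossings to the other side of `merge_cri_at` makes them crossings, and the
strand passes the vertex in the opposite direction. -/
lemma cr_merge_at (i m n : ℕ) (h : i + 3 ≤ m := by omega) (hn : n + 1 = m := by omega) :
    el .merge (i + 1) m n ≫ cr n i = cr m i ≫ cr m (i + 1) ≫ el .merge i m n := by
  have e := merge_cri_at i m n h hn
  calc el .merge (i + 1) m n ≫ cr n i
      = cr m i ≫ cr m (i + 1) ≫ (cri m (i + 1) ≫ cri m i ≫ el .merge (i + 1) m n) ≫ cr n i := by
        rw [Category.assoc, ← Category.assoc (cr m (i + 1)), cr_comp_cri m (i + 1),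
          Category.id_comp, Category.assoc, ← Category.assoc (cr m i), cr_comp_cri m i,
          Category.id_comp]
    _ = cr m i ≫ cr m (i + 1) ≫ el .merge i m n := by
        rw [← e, Category.assoc, cri_comp_cr n i, Category.comp_id]

/-- The two crossings carry one strand past the split and then past the merge. -/
lemma I_braid (i n : ℕ) (h : i + 3 ≤ n) : place i n n I₂ ≫ cr n (i + 1) ≫ cr n i
    = cr n (i + 1) ≫ cr n i ≫ place (i + 1) n n I₂ := by
  rw [place_I i n, place_I (i + 1) n, Category.assoc, split_cr_at i (n - 1) n, ← Category.assoc,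
    merge_cr_at i n (n - 1)]
  simp only [Category.assoc]

lemma H_braid (i n : ℕ) (h : i + 3 ≤ n) : place i n n H₂ ≫ cr n (i + 1) ≫ cr n i
    = cr n (i + 1) ≫ cr n i ≫ place (i + 1) n n H₂ := by
  have h1 : el .split i n (n + 1) ≫ cr (n + 1) (i + 1 + 1)
      = cr n (i + 1) ≫ el .split i n (n + 1) :=
    el_comb .split _ _ _ _ (i + 1) i (i + 1 + 1) n (n + 1) le_rfl (by omega) rfl rfl
  have h2 : cr (n + 1) i ≫ el .merge (i + 1 + 1) (n + 1) n
      = el .merge (i + 1 + 1) (n + 1) n ≫ cr n i :=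
    comb_el .merge _ _ _ _ i (i + 1 + 1) (n + 1) n le_rfl (by simp only [Piece.src]; omega) rfl
  rw [place_H i n, place_H (i + 1) n, Category.assoc, ← Category.assoc (el .merge (i + 1) _ _),
    merge_cr_at (i + 1) (n + 1) n, Category.assoc, Category.assoc, ← h2,
    ← Category.assoc (el .split i _ _), h1, Category.assoc,
    ← Category.assoc (cr (n + 1) (i + 1)), ← Category.assoc (el .split i _ _),
    split_cr_at i n (n + 1), Category.assoc]

/-- The square relation expresses U through H², I, H and the identity, all already intertwined; its
coefficient q² + 1 + q⁻² is invertible. -/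
lemma U_braid (i n : ℕ) (h : i + 3 ≤ n) : place i n n U₂ ≫ cr n (i + 1) ≫ cr n i
    = cr n (i + 1) ≫ cr n i ≫ place (i + 1) n n U₂ := by
  have e1 := square_at i n
  have e2 := square_at (i + 1) n
  have key : (place i n n H₂ ≫ place i n n H₂) ≫ cr n (i + 1) ≫ cr n i
      = cr n (i + 1) ≫ cr n i ≫ place (i + 1) n n H₂ ≫ place (i + 1) n n H₂ := by
    rw [Category.assoc, H_braid i n h, ← Category.assoc, ← Category.assoc,
      Category.assoc _ _ (cr n i), H_braid i n h]
    simp only [Category.assoc]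
  rw [e1, e2] at key
  simp only [Preadditive.add_comp, Preadditive.comp_add, Linear.smul_comp, Linear.comp_smul,
    Category.id_comp, Category.comp_id, I_braid i n h, H_braid i n h, add_right_inj] at key
  rw [smul_right_injective _ squareValue_ne_zero |>.eq_iff, add_left_inj] at key
  exact key

lemma cr_braid (i n : ℕ) (h : i + 3 ≤ n) :
    cr n i ≫ cr n (i + 1) ≫ cr n i = cr n (i + 1) ≫ cr n i ≫ cr n (i + 1) := by
  have e (k : ℕ) (hk : k + 2 ≤ n) : cr n k = (1 + q ^ 2)⁻¹ • place k n n I₂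
      + (1 + q⁻¹ ^ 2)⁻¹ • place k n n H₂ + (q ^ 2 + q ^ 4)⁻¹ • place k n n U₂
      + (q⁻¹ ^ 2 + q⁻¹ ^ 4)⁻¹ • 𝟙 (ob n) := place_comb k n _ _ _ _ hk
  have hI := I_braid i n h
  have hH := H_braid i n h
  have hU := U_braid i n h
  rw [← Category.assoc (cr n (i + 1)) (cr n i)] at hI hH hU ⊢
  -- `B` is made opaque so that only the outer crossings are expanded below, not those inside `B`.
  obtain ⟨B, hB⟩ : ∃ B, B = cr n (i + 1) ≫ cr n i := ⟨_, rfl⟩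
  rw [← hB] at hI hH hU ⊢
  rw [e i (by omega), e (i + 1) (by omega)]
  simp only [Preadditive.add_comp, Preadditive.comp_add, Linear.smul_comp, Linear.comp_smul,
    Category.id_comp, Category.comp_id, hI, hH, hU]

/-! ## The algebra generated by the crossings -/

/-- The subalgebra of the diagram algebra generated by the crossings. -/
def crAlg (n : ℕ) : Subalgebra Coeff (EndAlg n) := Algebra.adjoin Coeff (Set.range (crossing n))

/-- Membership in the algebra generated by the crossings. -/
def Gen (n : ℕ) (f : ob n ⟶ ob n) : Prop := (f : EndAlg n) ∈ crAlg n

section Gen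

variable {n : ℕ} {f g : ob n ⟶ ob n}

/-- The factors are swapped because multiplication in `End` is opposite to `≫`. -/
lemma Gen.comp (hf : Gen n f) (hg : Gen n g) : Gen n (f ≫ g) := (crAlg n).mul_mem hg hf

lemma Gen.id (n : ℕ) : Gen n (𝟙 (ob n)) := (crAlg n).one_mem

lemma Gen.add (hf : Gen n f) (hg : Gen n g) : Gen n (f + g) := (crAlg n).add_mem hf hg

lemma Gen.smul (c : Coeff) (hf : Gen n f) : Gen n (c • f) := (crAlg n).smul_mem hf c

lemma Gen.zero (n : ℕ) : Gen n 0 := (crAlg n).zero_mem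

lemma Gen.sub (hf : Gen n f) (hg : Gen n g) : Gen n (f - g) := (crAlg n).sub_mem hf hg

lemma Gen.of_smul {c : Coeff} (hc : c ≠ 0) (hf : Gen n (c • f)) : Gen n f := by
  have := hf.smul c⁻¹
  rwa [smul_smul, inv_mul_cancel₀ hc, one_smul] at this

lemma Gen.cr (n i : ℕ) (h : i + 2 ≤ n := by omega) : Gen n (cr n i) := by
  have := crossing_eq_place n ⟨i, by omega⟩
  exact Algebra.subset_adjoin ⟨⟨i, by omega⟩, this⟩

/-- An induction principle for the algebra generated by the crossings. -/
lemma Gen.induction {P : (ob n ⟶ ob n) → Prop} (hcr : ∀ i, i + 2 ≤ n → P (G2.cr n i))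
    (hid : P (𝟙 (ob n))) (hadd : ∀ f g, P f → P g → P (f + g))
    (hsmul : ∀ (c : Coeff) f, P f → P (c • f))
    (hcomp : ∀ f g, P f → P g → P (f ≫ g)) (hf : Gen n f) : P f := by
  have hf' : (f : EndAlg n) ∈ Algebra.adjoin Coeff (Set.range (crossing n)) := hf
  refine Algebra.adjoin_induction (A := EndAlg n) (p := fun x _ => P x) ?_ ?_ ?_ ?_ hf'
  · rintro _ ⟨i, rfl⟩
    rw [crossing_eq_place]
    exact hcr i (by omega)
  · intro c
    rw [Algebra.algebraMap_eq_smul_one]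
    exact hsmul c _ hid
  · intro x y _ _ hx hy
    exact hadd x y hx hy
  · intro x y _ _ hx hy
    exact hcomp y x hy hx

lemma Gen.place {k : ℕ} {f : ob k ⟶ ob k} (hf : Gen k f) (i n : ℕ) (h : i + k ≤ n := by omega) :
    Gen n (place i n n f) := by
  refine hf.induction (P := fun f => Gen n (G2.place i n n f)) ?_ ?_ ?_ ?_ ?_
  · intro j hj
    rw [place_cr i j k n hj h]
    exact Gen.cr n (i + j)
  · rw [place_id i n h]
    exact Gen.id n
  · intro f g hf hg
    rw [place_add i n n _ _ h rfl]
    exact hf.add hg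
  · intro c f hf
    rw [place_smul i n n _ _ h rfl]
    exact hf.smul c
  · intro f g hf hg
    rw [place_comp i n n n _ _ h rfl rfl]
    exact hf.comp hg

end Gen

lemma gen_cross : Gen 2 cross := by
  have h := Gen.cr 2 0
  have h2 : cr 2 0 = cross := by
    rw [cr, cross, place_comb 0 2, place_I 0 2, place_H 0 2, place_U 0 2, comb]
    rfl
  rwa [h2] at h

lemma gen_U : Gen 2 U₂ := by
  refine Gen.of_smul coeff_U_ne_zero ?_
  rw [← cross_cubic]
  exact (gen_cross.sub ((Gen.id 2).smul _)).comp
    ((gen_cross.add (Gen.id 2)).comp (gen_cross.add ((Gen.id 2).smul _)))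

lemma gen_I : Gen 2 I₂ := by
  refine Gen.of_smul coeff_I_ne_zero ?_
  rw [eq_sub_of_add_eq cross_quadratic.symm]
  exact ((gen_cross.sub ((Gen.id 2).smul _)).comp (gen_cross.add (Gen.id 2))).sub (gen_U.smul _)

lemma gen_H : Gen 2 H₂ := by
  refine Gen.of_smul (inv_ne_zero one_add_inv_q_sq_ne_zero) ?_
  have h : (1 + q⁻¹ ^ 2)⁻¹ • H₂ = cross - (1 + q ^ 2)⁻¹ • I₂ - (q ^ 2 + q ^ 4)⁻¹ • U₂
      - (q⁻¹ ^ 2 + q⁻¹ ^ 4)⁻¹ • 𝟙 (ob 2) := by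
    rw [cross, comb]; module
  rw [h]
  exact ((gen_cross.sub (gen_I.smul _)).sub (gen_U.smul _)).sub ((Gen.id 2).smul _)

lemma gen_comb (a b c d : Coeff) : Gen 2 (comb a b c d) :=
  (((gen_I.smul a).add (gen_H.smul b)).add (gen_U.smul c)).add ((Gen.id 2).smul d)

/-! ## Pairs of disjoint vertices -/

/-- Modulo products already known to be generated, two uses of the square relation and one of the
pentagon relation give three independent linear conditions on `M`, `T` and the desired `S`. -/
lemma gen_merge_split_aux : Gen 3 (el .merge 0 3 2 ≫ el .split 1 2 3) := by
  have IL := gen_I.place 0 3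
  have IR := gen_I.place 1 3
  have HL := gen_H.place 0 3
  have HR := gen_H.place 1 3
  have UL := gen_U.place 0 3
  have UR := gen_U.place 1 3
  have eI : place 0 3 3 I₂ = el .merge 0 3 2 ≫ el .split 0 2 3 := place_I 0 3
  have eI' : place 1 3 3 I₂ = el .merge 1 3 2 ≫ el .split 1 2 3 := place_I 1 3
  have hH : H₂ = el .split 0 2 3 ≫ el .merge 1 3 2 := rfl
  have hI : el .merge 0 2 1 ≫ el .split 0 1 2 = I₂ := rfl
  have hU : U₂ ≫ el .split 1 2 3 = U₂ ≫ el .split 0 2 3 := by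
    rw [U₂, Category.assoc, Category.assoc, cup_split 0 0 2 3]
  -- products of the generators
  have g1 : Gen 3 (el .merge 0 3 2 ≫ el .merge 0 2 1 ≫ el .cup 1 1 3) := by
    have := IL.comp UR
    rwa [eI, Category.assoc, split_UR] at this
  have g2 : Gen 3 (el .merge 0 3 2 ≫ el .merge 0 2 1 ≫ el .cup 0 1 3) := by
    have := g1.comp UL
    rwa [Category.assoc, Category.assoc, cup_UL] at this
  have g3 : Gen 3 (el .merge 0 3 2 ≫ I₂ ≫ el .split 0 2 3) := by
    have := g1.comp IL
    rwa [Category.assoc, Category.assoc, cup_IL, ← Category.assoc (el .merge 0 2 1), hI] at this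
  have g4 : Gen 3 (el .merge 0 3 2 ≫ I₂ ≫ el .split 1 2 3) := by
    have := g1.comp HL
    rwa [Category.assoc, Category.assoc, cup_HL, ← Category.assoc (el .merge 0 2 1), hI] at this
  have g5 : Gen 3 (el .merge 0 3 2 ≫ el .split 0 2 3 ≫ el .split 2 3 4 ≫ el .merge 1 4 3) := by
    have := IL.comp HR
    rwa [eI, Category.assoc, split_HR] at this
  have g6 : Gen 3 (el .merge 0 3 2 ≫ H₂ ≫ el .split 1 2 3) := by
    have := IL.comp IR
    rwa [eI, Category.assoc, split_IR] at this
  have g7 : Gen 3 (el .merge 0 3 2 ≫ el .split 0 2 3) := eI ▸ IL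
  -- the three relations
  have e1 := (IL.comp IR).comp IL
  have h1 : (place 0 3 3 I₂ ≫ place 1 3 3 I₂) ≫ place 0 3 3 I₂
      = el .merge 0 3 2 ≫ (H₂ ≫ H₂) ≫ el .split 0 2 3 := by
    -- The product of the three I's contains H twice, the second time with its horizontal edge
    -- tilted the other way.
    conv_rhs => rw [hH]; arg 2; arg 1; arg 2; rw [← hH, ← H_eq]
    rw [eI, eI']
    simp only [Category.assoc]
  rw [h1, square_rel] at e1
  have e2 := g5.comp HL
  rw [Category.assoc, tree_HL] at e2
  have e3 := g6.comp HL
  rw [Category.assoc, HsplitR_HL, hU] at e3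
  simp only [Preadditive.comp_add, Preadditive.comp_sub, Preadditive.add_comp, Linear.smul_comp,
    Linear.comp_smul, Category.id_comp] at e1 e2 e3
  obtain ⟨M, hM⟩ : ∃ M, M = el .merge 0 3 2 ≫ H₂ ≫ el .split 0 2 3 := ⟨_, rfl⟩
  obtain ⟨T, hT⟩ : ∃ T, T = el .merge 0 3 2 ≫ U₂ ≫ el .split 0 2 3 := ⟨_, rfl⟩
  obtain ⟨S, hS⟩ : ∃ S, S = el .merge 0 3 2 ≫ el .split 1 2 3 := ⟨_, rfl⟩
  rw [← hM, ← hT] at e1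
  rw [← hM, ← hS] at e2
  rw [← hM, ← hT, ← hS] at e3
  rw [← hS]
  have f1 : Gen 3 (-(q ^ 2 + q⁻¹ ^ 2) • M + (q ^ 2 + 1 + q⁻¹ ^ 2) • T) := by
    have := (e1.sub (g3.smul (-(q ^ 2 + q⁻¹ ^ 2)))).sub (g7.smul (q ^ 2 + 1 + q⁻¹ ^ 2))
    convert this using 1
    module
  have f2 : Gen 3 (-(q ^ 2 + q⁻¹ ^ 2) • M + (q ^ 2 + 1 + q⁻¹ ^ 2) • S) := by
    have := (e2.sub (g5.smul (-(q ^ 2 + q⁻¹ ^ 2)))).sub (g2.smul (q ^ 2 + 1 + q⁻¹ ^ 2))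
    convert this using 1
    module
  have f3 : Gen 3 (M - T - S) := by
    have := (((((((e3.sub g3).sub g4).sub g5).sub g6).add g7).add g1).add g2)
    convert this using 1
    abel
  -- This combination cancels `T` and `S`, leaving on `M` the coefficient −2(q² + q⁻²) + (q² + 1 +
  -- q⁻²).
  have f4 : Gen 3 ((1 - q ^ 2 - q⁻¹ ^ 2) • M) := by
    have := (f1.add f2).add (f3.smul (q ^ 2 + 1 + q⁻¹ ^ 2))
    convert this using 1
    module
  have hc : 1 - q ^ 2 - q⁻¹ ^ 2 ≠ 0 := by
    have := q_ne_zero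
    have h : 1 - q ^ 2 - q⁻¹ ^ 2 = (q ^ 2 - q ^ 4 - 1) / q ^ 2 := by field_simp
    rw [h]
    refine div_ne_zero ?_ (pow_ne_zero _ q_ne_zero)
    exact algebraMap_ne_zero_of_eval (.X ^ 2 - .X ^ 4 - 1) 1 (by simp [q]) (by norm_num)
  have hM := Gen.of_smul hc f4
  refine Gen.of_smul squareValue_ne_zero ?_
  have := f2.add (hM.smul (q ^ 2 + q⁻¹ ^ 2))
  convert this using 1
  module

lemma gen_merge_split_right (i n : ℕ) (h : i + 3 ≤ n := by omega) :
    Gen n (el .merge i n (n - 1) ≫ el .split (i + 1) (n - 1) n) := by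
  have e := gen_merge_split_aux.place i n
  rwa [place_comp i n (n - 1) n _ _ (by omega) (by omega) (by omega),
    place_el i n (n - 1) _ _ (by omega) (by omega) (by decide) (by decide),
    place_el i (n - 1) n _ _ (by omega) (by omega) (by decide) (by decide)] at e

lemma gen_cri (n i : ℕ) (h : i + 2 ≤ n := by omega) : Gen n (cri n i) :=
  (gen_comb _ _ _ _).place i n

/-- Crossings below and inverse crossings above drag the spare strand past the merge and past the
split, which turns this into the mirror-image product. -/
lemma gen_merge_split_left (i n : ℕ) (h : i + 3 ≤ n := by omega) :
    Gen n (el .merge (i + 1) n (n - 1) ≫ el .split i (n - 1) n) := by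
  have key : el .merge (i + 1) n (n - 1) ≫ el .split i (n - 1) n
      = cr n i ≫ cr n (i + 1) ≫ (el .merge i n (n - 1) ≫ el .split (i + 1) (n - 1) n) ≫
        cri n i ≫ cri n (i + 1) := by
    have h1 := cr_merge_at i n (n - 1)
    have h2 := split_cr_at i (n - 1) n
    calc el .merge (i + 1) n (n - 1) ≫ el .split i (n - 1) n
        = el .merge (i + 1) n (n - 1) ≫ (el .split i (n - 1) n ≫ cr n (i + 1) ≫ cr n i) ≫
            cri n i ≫ cri n (i + 1) := by
          rw [Category.assoc, Category.assoc, ← Category.assoc (cr n i), cr_comp_cri n i,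
            Category.id_comp, cr_comp_cri n (i + 1), Category.comp_id]
      _ = _ := by
          rw [h2, Category.assoc, ← Category.assoc (el .merge (i + 1) n (n - 1)), h1]
          simp only [Category.assoc]
  rw [key]
  exact (Gen.cr n i).comp ((Gen.cr n (i + 1)).comp ((gen_merge_split_right i n).comp
    ((gen_cri n i).comp (gen_cri n (i + 1)))))

lemma gen_merge_split (i n : ℕ) (h : i + 2 ≤ n := by omega) :
    Gen n (el .merge i n (n - 1) ≫ el .split i (n - 1) n) := by
  rw [← place_I i n]
  exact gen_I.place i n

lemma gen_cap_cup (i n : ℕ) (h : i + 2 ≤ n := by omega) :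
    Gen n (el .cap i n (n - 2) ≫ el .cup i (n - 2) n) := by
  rw [← place_U i n]
  exact gen_U.place i n

/-! ## The representation of the braid group -/

/-- The crossings as units of the diagram algebra. -/
def crossUnit (n : ℕ) (i : Fin (n - 1)) : (EndAlg n)ˣ where
  val := cr n i
  inv := cri n i
  val_inv := cri_comp_cr n i
  inv_val := cr_comp_cri n i

lemma crossUnit_rels (n : ℕ) : ∀ r ∈ braidRels n, FreeGroup.lift (crossUnit n) r = 1 := by
  rintro r (⟨i, j, hij, rfl⟩ | ⟨i, j, hij, rfl⟩)
  · rw [map_mul, map_inv, mul_inv_eq_one]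
    simp only [map_mul, FreeGroup.lift_apply_of]
    ext1
    -- The symmetric form is needed because products in `End` read opposite to `≫`.
    exact (comb_comm _ _ _ _ _ _ _ _ i j n (by omega) (by omega)).symm
  · rw [map_mul, map_inv, mul_inv_eq_one]
    simp only [map_mul, FreeGroup.lift_apply_of]
    ext1
    have e := cr_braid i n (by omega)
    rw [hij] at e
    exact e

/-- The action of the braid group by crossings. -/
def braidHom (n : ℕ) : BraidGroup n →* EndAlg n :=
  (Units.coeHom _).comp (PresentedGroup.toGroup (crossUnit_rels n))

/-- The homomorphism from the group algebra of the braid group to the diagram algebra. -/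
def braidAlgHom (n : ℕ) : MonoidAlgebra Coeff (BraidGroup n) →ₐ[Coeff] EndAlg n :=
  MonoidAlgebra.lift Coeff (EndAlg n) (BraidGroup n) (braidHom n)

lemma braidAlgHom_of (n : ℕ) (i : Fin (n - 1)) :
    braidAlgHom n (MonoidAlgebra.of Coeff (BraidGroup n) (braidGen n i)) = crossing n i := by
  rw [braidAlgHom, MonoidAlgebra.lift_of, braidHom, MonoidHom.comp_apply, braidGen,
    PresentedGroup.toGroup.of, crossing_eq_place]
  rfl

lemma crAlg_le_range (n : ℕ) : crAlg n ≤ (braidAlgHom n).range := by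
  refine Algebra.adjoin_le ?_
  rintro _ ⟨i, rfl⟩
  exact ⟨_, braidAlgHom_of n i⟩

/-! ## Moving caps, cups and vertices to the right -/

/-- Steps between neighbouring positions are multiplied together; each cup and cap meeting in the
middle form a zigzag and cancel. -/
lemma gen_cap_cup_of_le (n i k : ℕ) (h : i + k + 2 ≤ n) :
    Gen n (el .cap (i + k) n (n - 2) ≫ el .cup i (n - 2) n) ∧
      Gen n (el .cap i n (n - 2) ≫ el .cup (i + k) (n - 2) n) := by
  induction k generalizing i with
  | zero => exact ⟨gen_cap_cup i n, gen_cap_cup i n⟩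
  | succ k ih =>
    obtain ⟨h1, h2⟩ := ih (i + 1) (by omega)
    rw [show i + 1 + k = i + (k + 1) by omega] at h1 h2
    constructor
    · have e := h1.comp (gen_cap_cup i n)
      rw [Category.assoc, ← Category.assoc (el .cup (i + 1) (n - 2) n),
        cup_cap_left i (n - 2) n (by omega) (by omega), Category.id_comp] at e
      exact e
    · have e := (gen_cap_cup i n).comp h2
      rw [Category.assoc, ← Category.assoc (el .cup i (n - 2) n),
        cup_cap_right i (n - 2) n (by omega) (by omega), Category.id_comp] at e
      exact e

/-- The same telescoping as for caps and cups, except that a bigon forms in the middle and its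
nonzero value is divided out. -/
lemma gen_merge_split_of_le (n i k : ℕ) (h : i + k + 2 ≤ n) :
    Gen n (el .merge (i + k) n (n - 1) ≫ el .split i (n - 1) n) ∧
      Gen n (el .merge i n (n - 1) ≫ el .split (i + k) (n - 1) n) := by
  induction k generalizing i with
  | zero => exact ⟨gen_merge_split i n, gen_merge_split i n⟩
  | succ k ih =>
    obtain ⟨h1, h2⟩ := ih (i + 1) (by omega)
    rw [show i + 1 + k = i + (k + 1) by omega] at h1 h2
    have hs := split_merge_self (i + 1) (n - 1) n (by omega) (by omega)
    constructor
    · have e := h1.comp (gen_merge_split_left i n)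
      rw [Category.assoc, ← Category.assoc (el .split (i + 1) (n - 1) n), hs, Linear.smul_comp,
        Linear.comp_smul, Category.id_comp] at e
      exact e.of_smul bigonValue_ne_zero
    · have e := (gen_merge_split_right i n).comp h2
      rw [Category.assoc, ← Category.assoc (el .split (i + 1) (n - 1) n), hs, Linear.smul_comp,
        Linear.comp_smul, Category.id_comp] at e
      exact e.of_smul bigonValue_ne_zero

/-- An element on the first `n` strands is disjoint from a cup or cap at the right end, and so
slides past it. -/
lemma Gen.comp_cup_cap {n : ℕ} {x : ob n ⟶ ob n} (hx : Gen n x) :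
    x ≫ el .cup n n (n + 2) = el .cup n n (n + 2) ≫ G2.place 0 (n + 2) (n + 2) x ∧
      G2.place 0 (n + 2) (n + 2) x ≫ el .cap n (n + 2) n = el .cap n (n + 2) n ≫ x := by
  refine hx.induction (P := fun x =>
    x ≫ el .cup n n (n + 2) = el .cup n n (n + 2) ≫ G2.place 0 (n + 2) (n + 2) x ∧
      G2.place 0 (n + 2) (n + 2) x ≫ el .cap n (n + 2) n = el .cap n (n + 2) n ≫ x) ?_ ?_ ?_ ?_ ?_
  · intro i hi
    rw [place_cr 0 i n (n + 2) hi, Nat.zero_add]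
    exact ⟨comb_el .cup _ _ _ _ i n n (n + 2) hi le_rfl rfl,
      comb_el .cap _ _ _ _ i n (n + 2) n hi le_rfl rfl⟩
  · rw [place_id 0 (n + 2)]
    simp
  · intro f g hf hg
    rw [place_add 0 (n + 2) (n + 2), Preadditive.add_comp, Preadditive.comp_add,
      Preadditive.add_comp, Preadditive.comp_add, hf.1, hf.2, hg.1, hg.2]
    exact ⟨rfl, rfl⟩
  · intro c f hf
    rw [place_smul 0 (n + 2) (n + 2), Linear.smul_comp, Linear.comp_smul, Linear.smul_comp,
      Linear.comp_smul, hf.1, hf.2]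
    exact ⟨rfl, rfl⟩
  · intro f g hf hg
    rw [place_comp 0 (n + 2) (n + 2) (n + 2) _ _ (by omega) (by omega) (by omega)]
    constructor
    · rw [Category.assoc, hg.1, ← Category.assoc, hf.1, Category.assoc]
    · rw [Category.assoc, hg.2, ← Category.assoc, hf.2, Category.assoc]

/-- A circle is inserted at the right end and divided by its value. Its lower half slides below `x`;
its upper half pairs with the cup at `j`, giving a generated element. -/
lemma Gen.comp_cup {n : ℕ} {x : ob n ⟶ ob n} (hx : Gen n x) (j : ℕ) (hj : j ≤ n) :
    ∃ y, Gen (n + 2) y ∧ x ≫ el .cup j n (n + 2) = el .cup n n (n + 2) ≫ y := by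
  refine ⟨loopValue⁻¹ • (G2.place 0 (n + 2) (n + 2) x ≫
    el .cap n (n + 2) n ≫ el .cup j n (n + 2)), Gen.smul _ ((hx.place 0 (n + 2)).comp ?_), ?_⟩
  · have := (gen_cap_cup_of_le (n + 2) j (n - j) (by omega)).1
    rwa [Nat.add_sub_cancel' hj] at this
  · rw [Linear.comp_smul, ← Category.assoc, ← hx.comp_cup_cap.1, Category.assoc,
      ← Category.assoc (el .cup n n (n + 2)), cup_cap_self n n (n + 2) le_rfl rfl,
      Linear.smul_comp, Category.id_comp, Linear.comp_smul, smul_smul,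
      inv_mul_cancel₀ loopValue_ne_zero, one_smul]

lemma Gen.cap_comp {n : ℕ} {x : ob n ⟶ ob n} (hx : Gen n x) (j : ℕ) (hj : j ≤ n) :
    ∃ y, Gen (n + 2) y ∧ el .cap j (n + 2) n ≫ x = y ≫ el .cap n (n + 2) n := by
  refine ⟨loopValue⁻¹ • ((el .cap j (n + 2) n ≫ el .cup n n (n + 2)) ≫
    G2.place 0 (n + 2) (n + 2) x), Gen.smul _ (Gen.comp ?_ (hx.place 0 (n + 2))), ?_⟩
  · have := (gen_cap_cup_of_le (n + 2) j (n - j) (by omega)).2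
    rwa [Nat.add_sub_cancel' hj] at this
  · rw [Linear.smul_comp, Category.assoc, hx.comp_cup_cap.2, Category.assoc,
      ← Category.assoc (el .cup n n (n + 2)), cup_cap_self n n (n + 2) le_rfl rfl,
      Linear.smul_comp, Category.id_comp, Linear.comp_smul, smul_smul,
      inv_mul_cancel₀ loopValue_ne_zero, one_smul]

/-- A bigon is inserted above the split at `i` and divided by its value; its merge then pairs with
the split at `j`. -/
lemma split_eq_split_comp (n i j : ℕ) (hi : i + 1 ≤ n) (hj : j + 1 ≤ n) :
    ∃ y, Gen (n + 1) y ∧ el .split j n (n + 1) = el .split i n (n + 1) ≫ y := by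
  refine ⟨bigonValue⁻¹ • (el .merge i (n + 1) n ≫ el .split j n (n + 1)), Gen.smul _ ?_, ?_⟩
  · rcases le_total i j with h | h
    · have := (gen_merge_split_of_le (n + 1) i (j - i) (by omega)).2
      rwa [Nat.add_sub_cancel' h] at this
    · have := (gen_merge_split_of_le (n + 1) j (i - j) (by omega)).1
      rwa [Nat.add_sub_cancel' h] at this
  · rw [Linear.comp_smul, ← Category.assoc, split_merge_self i n (n + 1) hi rfl,
      Linear.smul_comp, Category.id_comp, smul_smul,
      inv_mul_cancel₀ bigonValue_ne_zero, one_smul]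

lemma merge_eq_comp_merge (n i j : ℕ) (hi : i + 1 ≤ n) (hj : j + 1 ≤ n) :
    ∃ y, Gen (n + 1) y ∧ el .merge j (n + 1) n = y ≫ el .merge i (n + 1) n := by
  refine ⟨bigonValue⁻¹ • (el .merge j (n + 1) n ≫ el .split i n (n + 1)), Gen.smul _ ?_, ?_⟩
  · rcases le_total j i with h | h
    · have := (gen_merge_split_of_le (n + 1) j (i - j) (by omega)).2
      rwa [Nat.add_sub_cancel' h] at this
    · have := (gen_merge_split_of_le (n + 1) i (j - i) (by omega)).1
      rwa [Nat.add_sub_cancel' h] at this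
  · rw [Linear.smul_comp, Category.assoc, split_merge_self i n (n + 1) hi rfl,
      Linear.comp_smul, Category.comp_id, smul_smul,
      inv_mul_cancel₀ bigonValue_ne_zero, one_smul]

/-- It suffices to treat single crossings below a split of the last strand. A crossing away from
that strand commutes with the split, and the last crossing slides past it by `split_cr_at`. The
position of the split is adjusted by `split_eq_split_comp`. -/
lemma Gen.comp_split {n : ℕ} {x : ob n ⟶ ob n} (hx : Gen n x) (i j : ℕ) (hi : i + 1 ≤ n)
    (hj : j + 1 ≤ n) :
    ∃ y, Gen (n + 1) y ∧ x ≫ el .split j n (n + 1) = el .split i n (n + 1) ≫ y := by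
  have key : ∃ y, Gen (n + 1) y ∧
      x ≫ el .split (n - 1) n (n + 1) = el .split (n - 1) n (n + 1) ≫ y := by
    refine hx.induction (P := fun x => ∃ y, Gen (n + 1) y ∧
      x ≫ el .split (n - 1) n (n + 1) = el .split (n - 1) n (n + 1) ≫ y) ?_ ?_ ?_ ?_ ?_
    · intro i hi
      rcases Nat.lt_or_ge (i + 2) n with h | h
      · exact ⟨_, Gen.cr (n + 1) i, comb_el .split _ _ _ _ i (n - 1) n (n + 1) (by omega)
          (by simp only [Piece.src]; omega) rfl⟩
      · obtain rfl : n = i + 2 := by omega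
        obtain ⟨y, hy, e⟩ := split_eq_split_comp (i + 2) (i + 1) i (by omega) (by omega)
        refine ⟨y ≫ G2.cr (i + 3) (i + 1) ≫ G2.cr (i + 3) i,
          hy.comp ((Gen.cr _ _).comp (Gen.cr _ _)), ?_⟩
        rw [← Category.assoc, Nat.add_sub_assoc (by omega)]
        rw [show i + (2 - 1) = i + 1 from rfl, ← e]
        exact (split_cr_at i (i + 2) (i + 3)).symm
    · exact ⟨_, Gen.id _, by simp⟩
    · rintro f g ⟨y, hy, ey⟩ ⟨z, hz, ez⟩
      exact ⟨_, hy.add hz, by rw [Preadditive.add_comp, Preadditive.comp_add, ey, ez]⟩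
    · rintro c f ⟨y, hy, ey⟩
      exact ⟨_, hy.smul c, by rw [Linear.smul_comp, Linear.comp_smul, ey]⟩
    · rintro f g ⟨y, hy, ey⟩ ⟨z, hz, ez⟩
      exact ⟨_, hy.comp hz, by rw [Category.assoc, ez, ← Category.assoc, ey, Category.assoc]⟩
  obtain ⟨y, hy, ey⟩ := key
  obtain ⟨z, hz, ez⟩ := split_eq_split_comp n (n - 1) j (by omega) hj
  obtain ⟨w, hw, ew⟩ := split_eq_split_comp n i (n - 1) hi (by omega)
  refine ⟨_, hw.comp (hy.comp hz), ?_⟩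
  rw [ez, ← Category.assoc, ey, Category.assoc, ← Category.assoc (el .split i n (n + 1)), ← ew]

lemma Gen.merge_comp {n : ℕ} {x : ob n ⟶ ob n} (hx : Gen n x) (i j : ℕ) (hi : i + 1 ≤ n)
    (hj : j + 1 ≤ n) :
    ∃ y, Gen (n + 1) y ∧ el .merge j (n + 1) n ≫ x = y ≫ el .merge i (n + 1) n := by
  have key : ∃ y, Gen (n + 1) y ∧
      el .merge (n - 1) (n + 1) n ≫ x = y ≫ el .merge (n - 1) (n + 1) n := by
    refine hx.induction (P := fun x => ∃ y, Gen (n + 1) y ∧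
      el .merge (n - 1) (n + 1) n ≫ x = y ≫ el .merge (n - 1) (n + 1) n) ?_ ?_ ?_ ?_ ?_
    · intro i hi
      rcases Nat.lt_or_ge (i + 2) n with h | h
      · exact ⟨_, Gen.cr (n + 1) i, (comb_el .merge _ _ _ _ i (n - 1) (n + 1) n (by omega)
          (by simp only [Piece.src]; omega) rfl).symm⟩
      · obtain rfl : n = i + 2 := by omega
        obtain ⟨y, hy, e⟩ := merge_eq_comp_merge (i + 2) (i + 1) i (by omega) (by omega)
        refine ⟨(G2.cr (i + 3) i ≫ G2.cr (i + 3) (i + 1)) ≫ y,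
          ((Gen.cr _ _).comp (Gen.cr _ _)).comp hy, ?_⟩
        rw [Category.assoc, Nat.add_sub_assoc (by omega)]
        rw [show i + (2 - 1) = i + 1 from rfl, ← e, Category.assoc]
        exact cr_merge_at i (i + 3) (i + 2)
    · exact ⟨_, Gen.id _, by simp⟩
    · rintro f g ⟨y, hy, ey⟩ ⟨z, hz, ez⟩
      exact ⟨_, hy.add hz, by rw [Preadditive.add_comp, Preadditive.comp_add, ey, ez]⟩
    · rintro c f ⟨y, hy, ey⟩
      exact ⟨_, hy.smul c, by rw [Linear.smul_comp, Linear.comp_smul, ey]⟩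
    · rintro f g ⟨y, hy, ey⟩ ⟨z, hz, ez⟩
      exact ⟨_, hy.comp hz, by rw [← Category.assoc, ey, Category.assoc, ez, Category.assoc]⟩
  obtain ⟨y, hy, ey⟩ := key
  obtain ⟨z, hz, ez⟩ := merge_eq_comp_merge n (n - 1) j (by omega) hj
  obtain ⟨w, hw, ew⟩ := merge_eq_comp_merge n i (n - 1) hi (by omega)
  refine ⟨_, (hz.comp hy).comp hw, ?_⟩
  rw [ez, Category.assoc, ey, ← Category.assoc, Category.assoc (z ≫ y), ← ew]

/-! ## Diagrams without local maxima or without local minima -/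

/-- The morphism is a composition of cups and splits. -/
inductive UpWord (r : ℕ) : (n : ℕ) → (ob r ⟶ ob n) → Prop
  | id : UpWord r r (𝟙 (ob r))
  | cup {n f} (i : ℕ) : i ≤ n → UpWord r n f → UpWord r (n + 2) (f ≫ el .cup i n (n + 2))
  | split {n f} (i : ℕ) : i + 1 ≤ n → UpWord r n f → UpWord r (n + 1) (f ≫ el .split i n (n + 1))

/-- The morphism is a composition of caps and merges. -/
inductive DownWord (r : ℕ) : (n : ℕ) → (ob n ⟶ ob r) → Prop
  | id : DownWord r r (𝟙 (ob r))
  | cap {n f} (i : ℕ) : i ≤ n → DownWord r n f → DownWord r (n + 2) (el .cap i (n + 2) n ≫ f)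
  | merge {n f} (i : ℕ) : i + 1 ≤ n → DownWord r n f →
      DownWord r (n + 1) (el .merge i (n + 1) n ≫ f)

/-- Cups at the right end. -/
inductive RightCups (r : ℕ) : (n : ℕ) → (ob r ⟶ ob n) → Prop
  | id : RightCups r r (𝟙 (ob r))
  | cup {n f} : RightCups r n f → RightCups r (n + 2) (f ≫ el .cup n n (n + 2))

/-- Cups at the right end, followed by a split of the last strand. -/
inductive RightCupsSplit (r : ℕ) : (n : ℕ) → (ob r ⟶ ob n) → Prop
  | split {n f} : RightCups r (n + 1) f →
      RightCupsSplit r (n + 2) (f ≫ el .split n (n + 1) (n + 2))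

/-- Caps at the right end. -/
inductive RightCaps (r : ℕ) : (n : ℕ) → (ob n ⟶ ob r) → Prop
  | id : RightCaps r r (𝟙 (ob r))
  | cap {n f} : RightCaps r n f → RightCaps r (n + 2) (el .cap n (n + 2) n ≫ f)

/-- A merge of the last two strands, followed by caps at the right end. -/
inductive RightMergeCaps (r : ℕ) : (n : ℕ) → (ob n ⟶ ob r) → Prop
  | merge {n f} : RightCaps r (n + 1) f →
      RightMergeCaps r (n + 2) (el .merge n (n + 2) (n + 1) ≫ f)

/-- Each new cup or split is moved to the right end through the generated factor accumulated so far.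
A second split does not persist: together with the first it becomes a cup followed by a generated
element. -/
lemma UpWord.exists_rightCups {r n : ℕ} {u : ob r ⟶ ob n} (hu : UpWord r n u) :
    ∃ f x, (RightCups r n f ∨ RightCupsSplit r n f) ∧ Gen n x ∧ u = f ≫ x := by
  induction hu with
  | id => exact ⟨_, _, .inl .id, Gen.id r, by simp⟩
  | @cup n u i hi _ ih =>
    obtain ⟨f, x, hf, hx, rfl⟩ := ih
    obtain ⟨y, hy, e⟩ := hx.comp_cup i hi
    rcases hf with hf | hf
    · exact ⟨_, y, .inl (.cup hf), hy, by rw [Category.assoc, e, Category.assoc]⟩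
    · cases hf with
      | @split n g hg =>
        obtain ⟨z, hz, ez⟩ := split_eq_split_comp (n + 3) (n + 2) n (by omega) (by omega)
        -- The new cup goes below the existing split, which is then moved back to the last strand at
        -- the cost of `z`.
        have h := exch .split .cup n (n + 1) (n + 1) (n + 2) (n + 3) (n + 4) (n + 2)
        refine ⟨_, z ≫ y, .inr (.split (.cup hg)), hz.comp hy, ?_⟩
        rw [Category.assoc, e, Category.assoc, ← Category.assoc (el .split n (n + 1) (n + 2)), h,
          ez]
        simp only [Category.assoc]
  | @split n u i hi _ ih =>
    obtain ⟨f, x, hf, hx, rfl⟩ := ih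
    rcases hf with hf | hf
    · obtain ⟨k, rfl⟩ : ∃ k, n = k + 1 := ⟨n - 1, by omega⟩
      obtain ⟨y, hy, e⟩ := hx.comp_split k i (by omega) hi
      exact ⟨_, y, .inr (.split hf), hy, by rw [Category.assoc, e, Category.assoc]⟩
    · cases hf with
      | @split n g hg =>
        obtain ⟨y, hy, e⟩ := hx.comp_split (n + 1) i (by omega) hi
        -- The earlier split is opened into a cup and a merge; this merge and the new split form a
        -- generated pair.
        have h := cup_merge_left n (n + 1) (n + 3) (n + 2) (by omega) rfl rfl
        refine ⟨g ≫ el .cup (n + 1) (n + 1) (n + 3),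
          (el .merge n (n + 3) (n + 2) ≫ el .split (n + 1) (n + 2) (n + 3)) ≫ y,
          .inl (.cup hg), (gen_merge_split_right n (n + 3)).comp hy, ?_⟩
        rw [Category.assoc, e, ← h]
        simp only [Category.assoc]

lemma DownWord.exists_rightCaps {r n : ℕ} {u : ob n ⟶ ob r} (hu : DownWord r n u) :
    ∃ f x, (RightCaps r n f ∨ RightMergeCaps r n f) ∧ Gen n x ∧ u = x ≫ f := by
  induction hu with
  | id => exact ⟨_, _, .inl .id, Gen.id r, by simp⟩
  | @cap n u i hi _ ih =>
    obtain ⟨f, x, hf, hx, rfl⟩ := ih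
    obtain ⟨y, hy, e⟩ := hx.cap_comp i hi
    rcases hf with hf | hf
    · exact ⟨_, y, .inl (.cap hf), hy, by rw [← Category.assoc, e, Category.assoc]⟩
    · cases hf with
      | @merge n g hg =>
        obtain ⟨z, hz, ez⟩ := merge_eq_comp_merge (n + 3) (n + 2) n (by omega) (by omega)
        have h := exch .merge .cap n (n + 2) (n + 4) (n + 3) (n + 2) (n + 1) (n + 1)
        refine ⟨_, y ≫ z, .inr (.merge (.cap hg)), hy.comp hz, ?_⟩
        rw [← Category.assoc, e, Category.assoc,
          ← Category.assoc (el .cap (n + 2) (n + 4) (n + 2)), ← h, ez]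
        simp only [Category.assoc]
  | @merge n u i hi _ ih =>
    obtain ⟨f, x, hf, hx, rfl⟩ := ih
    rcases hf with hf | hf
    · obtain ⟨k, rfl⟩ : ∃ k, n = k + 1 := ⟨n - 1, by omega⟩
      obtain ⟨y, hy, e⟩ := hx.merge_comp k i (by omega) hi
      exact ⟨_, y, .inr (.merge hf), hy, by rw [← Category.assoc, e, Category.assoc]⟩
    · cases hf with
      | @merge n g hg =>
        obtain ⟨y, hy, e⟩ := hx.merge_comp (n + 1) i (by omega) hi
        have h := split_cap_right n (n + 2) (n + 3) (n + 1)
        refine ⟨el .cap (n + 1) (n + 3) (n + 1) ≫ g,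
          y ≫ el .merge (n + 1) (n + 3) (n + 2) ≫ el .split n (n + 2) (n + 3),
          .inl (.cap hg), hy.comp (gen_merge_split_left n (n + 3)), ?_⟩
        rw [← Category.assoc, e, ← h]
        simp only [Category.assoc]

lemma RightCups.exists_eq {r n : ℕ} {f : ob r ⟶ ob n} (hf : RightCups r n f) :
    ∃ k, n = r + 2 * k := by
  induction hf with
  | id => exact ⟨0, rfl⟩
  | cup _ ih =>
    obtain ⟨k, rfl⟩ := ih
    exact ⟨k + 1, by omega⟩

lemma RightCaps.exists_eq {r n : ℕ} {f : ob n ⟶ ob r} (hf : RightCaps r n f) :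
    ∃ k, n = r + 2 * k := by
  induction hf with
  | id => exact ⟨0, rfl⟩
  | cap _ ih =>
    obtain ⟨k, rfl⟩ := ih
    exact ⟨k + 1, by omega⟩

/-- From the inside out: the generated element between the innermost pairs slides past the next cup,
leaving a cap below a cup. -/
lemma RightCaps.comp_rightCups {r n : ℕ} {f : ob n ⟶ ob r} (hf : RightCaps r n f) :
    ∀ {g : ob r ⟶ ob n}, RightCups r n g → Gen n (f ≫ g) := by
  induction hf with
  | id =>
    intro g hg
    cases hg with
    | id =>
      rw [Category.id_comp]
      exact Gen.id r
    | cup hg =>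
      obtain ⟨k, hk⟩ := hg.exists_eq
      omega
  | @cap n f hf ih =>
    intro g hg
    cases hg with
    | id =>
      obtain ⟨k, hk⟩ := hf.exists_eq
      omega
    | cup hg =>
      have hx := ih hg
      rw [Category.assoc, ← Category.assoc f, hx.comp_cup_cap.1, ← Category.assoc]
      exact (gen_cap_cup n (n + 2)).comp (hx.place 0 (n + 2))

/-- A diagram consisting of caps and merges, followed by cups and splits, is generated by the
crossings. -/
lemma DownWord.comp_upWord {r n : ℕ} {d : ob n ⟶ ob r} {u : ob r ⟶ ob n} (hd : DownWord r n d)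
    (hu : UpWord r n u) : Gen n (d ≫ u) := by
  obtain ⟨f, x, hf, hx, rfl⟩ := hu.exists_rightCups
  obtain ⟨f', y, hf', hy, rfl⟩ := hd.exists_rightCaps
  have key : Gen n (f' ≫ f) := by
    -- The mixed cases are impossible, because a single vertex changes the parity of `n - r`.
    rcases hf with hf | hf <;> rcases hf' with hf' | hf'
    · exact hf'.comp_rightCups hf
    · cases hf' with
      | merge hg =>
        obtain ⟨k, hk⟩ := hf.exists_eq
        obtain ⟨k', hk'⟩ := hg.exists_eq
        omega
    · cases hf with
      | split hg =>
        obtain ⟨k, hk⟩ := hf'.exists_eq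
        obtain ⟨k', hk'⟩ := hg.exists_eq
        omega
    · cases hf with
      | @split n g hg =>
        cases hf' with
        | @merge _ g' hg' =>
          -- The generated middle part is pulled above the split, so that the merge and the split
          -- become adjacent and form an I.
          obtain ⟨z, hz, e⟩ := (hg'.comp_rightCups hg).comp_split n n (by omega) (by omega)
          rw [Category.assoc, ← Category.assoc g', e, ← Category.assoc]
          exact Gen.comp (gen_merge_split n (n + 2)) hz
  have := (hy.comp key).comp hx
  simpa only [Category.assoc] using this

/-! ## Labelled diagrams -/

/-- The labels `f` of the strands below and `f'` of the strands above a layer with the piece `g` at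
position `i` agree along the vertical strands, and the ends of the piece all have label `x`. -/
structure Labelling {L : Type*} (g : Piece) (x : L) (i : ℕ) (f f' : ℕ → L) : Prop where
  left : ∀ k < i, f' k = f k
  right : ∀ k k', i + g.src ≤ k → k' + g.src = k + g.tgt → f' k' = f k
  src : ∀ k, i ≤ k → k < i + g.src → f k = x
  tgt : ∀ k, i ≤ k → k < i + g.tgt → f' k = x

/-- The labels of the vertices of a piece with label `x`. -/
def vertexLabels {L : Type*} (g : Piece) (x : L) : Set L := {y | g.IsVertex ∧ y = x}

section
variable {L : Type*} {g h : Piece} {x y : L} {i j : ℕ} {f₁ f₂ f₃ : ℕ → L}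

lemma Labelling.exchange_left (hh : Labelling h y j f₁ f₂) (hg : Labelling g x i f₂ f₃)
    (hij : i + g.src ≤ j) (j' : ℕ) (hj' : j' + g.src = j + g.tgt) :
    ∃ f', Labelling g x i f₁ f' ∧ Labelling h y j' f' f₃ := by
  -- After the interchange, the intermediate line agrees with the top line up to the upper ends of
  -- `g`, and with the shifted bottom line beyond them.
  refine ⟨fun k => if k < i + g.tgt then f₃ k else f₁ (k - g.tgt + g.src),
    ⟨fun k hk => ?_, fun k k' hk hk' => ?_, fun k hk hk' => ?_, fun k hk hk' => ?_⟩,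
    ⟨fun k hk => ?_, fun k k' hk hk' => ?_, fun k hk hk' => ?_, fun k hk hk' => ?_⟩⟩
  · rw [if_pos (by omega), hg.left k hk, hh.left k (by omega)]
  · rw [if_neg (by omega)]
    congr 1
    omega
  · rw [← hh.left k (by omega), hg.src k hk hk']
  · rw [if_pos hk', hg.tgt k hk hk']
  · split_ifs with hc
    · rfl
    · rw [hg.right (k - g.tgt + g.src) k (by omega) (by omega), hh.left _ (by omega)]
  · rw [if_neg (by omega), hg.right (k' - g.tgt + g.src) k' (by omega) (by omega),
      hh.right (k - g.tgt + g.src) _ (by omega) (by omega)]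
  · rw [if_neg (by omega), hh.src _ (by omega) (by omega)]
  · rw [hg.right (k - g.tgt + g.src) k (by omega) (by omega), hh.tgt _ (by omega) (by omega)]

lemma Labelling.exchange_right (hh : Labelling h y j f₁ f₂) (hg : Labelling g x i f₂ f₃)
    (hij : j + h.tgt ≤ i) (i' : ℕ) (hi' : i' + h.tgt = i + h.src) :
    ∃ f', Labelling g x i' f₁ f' ∧ Labelling h y j f' f₃ := by
  refine ⟨fun k => if k < j + h.src then f₁ k else f₃ (k - h.src + h.tgt),
    ⟨fun k hk => ?_, fun k k' hk hk' => ?_, fun k hk hk' => ?_, fun k hk hk' => ?_⟩,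
    ⟨fun k hk => ?_, fun k k' hk hk' => ?_, fun k hk hk' => ?_, fun k hk hk' => ?_⟩⟩
  · split_ifs with hc
    · rfl
    · rw [hg.left _ (by omega), hh.right k _ (by omega) (by omega)]
  · rw [if_neg (by omega), hg.right (k - h.src + h.tgt) _ (by omega) (by omega),
      hh.right k _ (by omega) (by omega)]
  · rw [← hh.right k (k - h.src + h.tgt) (by omega) (by omega), hg.src _ (by omega) (by omega)]
  · rw [if_neg (by omega), hg.tgt _ (by omega) (by omega)]
  · rw [if_pos (by omega), hg.left _ (by omega), hh.left k hk]
  · rw [if_neg (by omega)]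
    congr 1
    omega
  · rw [if_pos hk', hh.src k hk hk']
  · rw [hg.left _ (by omega), hh.tgt k hk hk']

lemma Labelling.cup_cap (hh : Labelling .cup y j f₁ f₂) (hg : Labelling .cap x i f₂ f₃)
    (hij : i ≤ j + 1) (hji : j ≤ i + 1) : f₃ = f₁ := by
  obtain ⟨h1, h2, -, h4⟩ := hh
  obtain ⟨g1, g2, g3, -⟩ := hg
  simp only [Piece.src, Piece.tgt, Nat.add_zero] at *
  funext k
  rcases Nat.lt_or_ge k i with hk | hk
  · rw [g1 k hk]
    rcases Nat.lt_or_ge k j with hk' | hk'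
    · exact h1 k hk'
    · rw [← h2 k _ hk' rfl, g3 (k + 2) (by omega) (by omega), ← g3 (k + 1) (by omega) (by omega),
        h4 k hk' (by omega), h4 (k + 1) (by omega) (by omega)]
  · rw [g2 (k + 2) k (by omega) (by omega)]
    rcases Nat.lt_or_ge k j with hk' | hk'
    · rw [← h1 k hk', g3 k hk (by omega), h4 (k + 2) (by omega) (by omega),
        ← h4 j le_rfl (by omega), g3 j (by omega) (by omega)]
    · exact h2 k _ hk' rfl

/-- The cup shares a strand with the merge, so their labels agree. Straightening the bent leg leaves
a split at the leftmost of the two positions. -/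
lemma Labelling.cup_merge (hh : Labelling .cup y j f₁ f₂) (hg : Labelling .merge x i f₂ f₃)
    (hij : i = j + 1 ∨ j = i + 1) : Labelling .split x (min i j) f₁ f₃ := by
  obtain ⟨h1, h2, -, h4⟩ := hh
  obtain ⟨g1, g2, g3, g4⟩ := hg
  simp only [Piece.src, Piece.tgt, Nat.add_zero] at *
  have hxy : x = y := by
    rcases hij with rfl | rfl
    · rw [← g3 (j + 1) le_rfl (by omega), h4 (j + 1) (by omega) (by omega)]
    · rw [← g3 (i + 1) (by omega) (by omega), h4 (i + 1) (by omega) (by omega)]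
  subst hxy
  refine ⟨fun k hk => ?_, fun k k' hk hk' => ?_, fun k hk hk' => ?_, fun k hk hk' => ?_⟩
  · rw [g1 k (by omega), h1 k (by omega)]
  · simp only [Piece.src, Piece.tgt] at *
    rw [g2 (k + 2) k' (by omega) (by omega), h2 k _ (by omega) rfl]
  · simp only [Piece.src] at *
    rcases hij with rfl | rfl
    · rw [← h2 k (k + 2) (by omega) rfl, g3 (k + 2) (by omega) (by omega)]
    · rw [← h1 k (by omega), g3 k (by omega) (by omega)]
  · simp only [Piece.tgt] at *
    by_cases hki : k = i
    · exact g4 k (by omega) (by omega)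
    · rcases hij with rfl | rfl
      · rw [g1 k (by omega), h4 k (by omega) (by omega)]
      · rw [g2 (k + 1) k (by omega) (by omega), h4 _ (by omega) (by omega)]

lemma Labelling.split_cap (hh : Labelling .split y j f₁ f₂) (hg : Labelling .cap x i f₂ f₃)
    (hij : i = j + 1 ∨ j = i + 1) : Labelling .merge y (min i j) f₁ f₃ := by
  obtain ⟨h1, h2, h3, h4⟩ := hh
  obtain ⟨g1, g2, g3, -⟩ := hg
  simp only [Piece.src, Piece.tgt, Nat.add_zero] at *
  have hxy : x = y := by
    rcases hij with rfl | rfl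
    · rw [← g3 (j + 1) le_rfl (by omega), h4 (j + 1) (by omega) (by omega)]
    · rw [← g3 (i + 1) (by omega) (by omega), h4 (i + 1) (by omega) (by omega)]
  subst hxy
  refine ⟨fun k hk => ?_, fun k k' hk hk' => ?_, fun k hk hk' => ?_, fun k hk hk' => ?_⟩
  · rw [g1 k (by omega), h1 k (by omega)]
  · simp only [Piece.src, Piece.tgt] at *
    rw [g2 (k + 1) k' (by omega) (by omega), h2 k _ (by omega) rfl]
  · simp only [Piece.src] at *
    by_cases hkj : k = j
    · exact h3 k (by omega) (by omega)
    · rcases hij with rfl | rfl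
      · rw [← h2 k (k + 1) (by omega) rfl, g3 _ (by omega) (by omega)]
      · rw [← h1 k (by omega), g3 k (by omega) (by omega)]
  · simp only [Piece.tgt] at *
    rcases hij with rfl | rfl
    · rw [g1 k (by omega), h4 k (by omega) (by omega)]
    · rw [g2 (k + 2) k (by omega) (by omega), h4 _ (by omega) (by omega)]

lemma Labelling.eq (hh : Labelling h y j f₁ f₂) (hg : Labelling g x i f₂ f₃)
    (hij : i < j + h.tgt) (hji : j < i + g.src) (hgs : 0 < g.src) (hht : 0 < h.tgt) : x = y := by
  rcases le_total i j with hc | hc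
  · rw [← hg.src j hc hji, hh.tgt j le_rfl (by omega)]
  · rw [← hg.src i le_rfl (by omega), hh.tgt i hc hij]
end

/-- A composition of cups and splits, ending with strands labelled by `f`, whose vertices have
distinct labels in the set `S`. -/
inductive LabelledUpWord {L : Type*} (r : ℕ) :
    (n : ℕ) → (ℕ → L) → Set L → (ob r ⟶ ob n) → Prop
  | id (f : ℕ → L) : LabelledUpWord r r f ∅ (𝟙 (ob r))
  | step {g : Piece} {x : L} {i n n' : ℕ} {f f' : ℕ → L} {S : Set L} {u : ob r ⟶ ob n} :
      g = .cup ∨ g = .split → i + g.src ≤ n → n' + g.src = n + g.tgt → Labelling g x i f f' →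
      Disjoint S (vertexLabels g x) → LabelledUpWord r n f S u →
      LabelledUpWord r n' f' (S ∪ vertexLabels g x) (u ≫ el g i n n')

lemma LabelledUpWord.upWord {L : Type*} {r n : ℕ} {f : ℕ → L} {S : Set L} {u : ob r ⟶ ob n}
    (hu : LabelledUpWord r n f S u) : UpWord r n u := by
  induction hu with
  | id => exact .id
  | @step g x i n n' f f' S u hg hi hn _ _ _ ih =>
    rcases hg with rfl | rfl
    · obtain rfl : n' = n + 2 := by simpa [Piece.src, Piece.tgt] using hn
      exact .cup i hi ih
    · obtain rfl : n' = n + 1 := by simp only [Piece.src, Piece.tgt] at hn; omega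
      exact .split i hi ih

/-! ### Rewriting diagrams as caps and merges followed by cups and splits -/

lemma DownWord.comp {r n p : ℕ} {d : ob n ⟶ ob r} {d' : ob r ⟶ ob p} (hd : DownWord r n d)
    (hd' : DownWord p r d') : DownWord p n (d ≫ d') := by
  induction hd with
  | id => simpa using hd'
  | cap i hi _ ih =>
    rw [Category.assoc]
    exact .cap i hi ih
  | merge i hi _ ih =>
    rw [Category.assoc]
    exact .merge i hi ih

lemma DownWord.of_el {g : Piece} (hg : g = .cap ∨ g = .merge) {i n p : ℕ} (hi : i + 2 ≤ n)
    (hp : p + g.src = n + g.tgt) : DownWord p n (el g i n p) := by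
  rw [← Category.comp_id (el g i n p)]
  rcases hg with rfl | rfl
  · obtain rfl : n = p + 2 := by simpa [Piece.src, Piece.tgt] using hp.symm
    exact .cap i (by omega) .id
  · obtain rfl : n = p + 1 := by simp only [Piece.src, Piece.tgt] at hp; omega
    exact .merge i (by omega) .id

/-- The morphism vanishes, or it is a multiple of a diagram consisting of caps and merges followed
by a labelled diagram consisting of cups and splits. -/
def Reducible {L : Type*} (r n : ℕ) (f : ℕ → L) (T : Set L) (w : ob r ⟶ ob n) : Prop :=
  w = 0 ∨ ∃ (c : Coeff) (k : ℕ) (d : ob r ⟶ ob k) (u : ob k ⟶ ob n) (S : Set L),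
    DownWord k r d ∧ LabelledUpWord k n f S u ∧ S ⊆ T ∧ w = c • (d ≫ u)

lemma LabelledUpWord.reducible {L : Type*} {r n : ℕ} {f : ℕ → L} {S : Set L} {u : ob r ⟶ ob n}
    (hu : LabelledUpWord r n f S u) : Reducible r n f S u :=
  .inr ⟨1, r, 𝟙 _, u, S, .id, hu, le_rfl, by simp⟩

lemma Reducible.mono {L : Type*} {r n : ℕ} {f : ℕ → L} {S T : Set L} {w : ob r ⟶ ob n}
    (hw : Reducible r n f S w) (h : S ⊆ T) : Reducible r n f T w :=
  hw.imp id fun ⟨c, k, d, u, S', hd, hu, hS, e⟩ => ⟨c, k, d, u, S', hd, hu, hS.trans h, e⟩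

lemma Reducible.down_comp {L : Type*} {r n p : ℕ} {f : ℕ → L} {T : Set L} {w : ob r ⟶ ob n}
    (hw : Reducible r n f T w) {d : ob p ⟶ ob r} (hd : DownWord r p d) :
    Reducible p n f T (d ≫ w) := by
  rcases hw with rfl | ⟨c, k, d', u, S, hd', hu, hS, rfl⟩
  · exact .inl (by simp)
  · exact .inr ⟨c, k, d ≫ d', u, S, hd.comp hd', hu, hS, by simp⟩

lemma Reducible.smul {L : Type*} {r n : ℕ} {f : ℕ → L} {T : Set L} {w : ob r ⟶ ob n}
    (hw : Reducible r n f T w) (a : Coeff) : Reducible r n f T (a • w) := by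
  rcases hw with rfl | ⟨c, k, d, u, S, hd, hu, hS, rfl⟩
  · exact .inl (by simp)
  · exact .inr ⟨a * c, k, d, u, S, hd, hu, hS, by rw [smul_smul]⟩

lemma Reducible.comp_up {L : Type*} {r n n' i : ℕ} {f f' : ℕ → L} {T : Set L} {w : ob r ⟶ ob n}
    (hw : Reducible r n f T w) {g : Piece} {x : L} (hg : g = .cup ∨ g = .split)
    (hi : i + g.src ≤ n) (hn : n' + g.src = n + g.tgt) (hl : Labelling g x i f f')
    (hT : Disjoint T (vertexLabels g x)) :
    Reducible r n' f' (T ∪ vertexLabels g x) (w ≫ el g i n n') := by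
  rcases hw with rfl | ⟨c, k, d, u, S, hd, hu, hS, rfl⟩
  · exact .inl (by simp)
  · exact .inr ⟨c, k, d, _, _, hd, .step hg hi hn hl (hT.mono_left hS) hu,
      Set.union_subset_union_left _ hS, by simp⟩

/-- The new cap or merge is pushed down by induction: it passes a distant piece, and on contact it
is removed, absorbed or transformed. Tracking labels keeps the vertices in distinct components
throughout. -/
lemma LabelledUpWord.comp_down {L : Type*} {r n : ℕ} {f : ℕ → L} {S : Set L} {u : ob r ⟶ ob n}
    (hu : LabelledUpWord r n f S u) :
    ∀ {g : Piece} {x : L} {i p : ℕ} {f' : ℕ → L}, g = .cap ∨ g = .merge → i + 2 ≤ n →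
      p + g.src = n + g.tgt → Labelling g x i f f' → Disjoint S (vertexLabels g x) →
      Reducible r p f' (S ∪ vertexLabels g x) (u ≫ el g i n p) := by
  induction hu with
  | id f =>
    intro g x i p f' hg hi hp _ _
    exact .inr ⟨1, p, _, _, _, .of_el hg hi hp, .id f', Set.empty_subset _, by simp⟩
  | @step h y j m n f₁ f₂ S u hh hj hn hl hS hu ih =>
    intro g x i p f₃ hg hi hp hl' hS'
    have hgs : g.src = 2 := by rcases hg with rfl | rfl <;> rfl
    have hht : h.tgt = 2 := by rcases hh with rfl | rfl <;> rfl
    have hdis : Disjoint (S ∪ vertexLabels g x) (vertexLabels h y) :=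
      Set.disjoint_union_left.2 ⟨hS, (Set.disjoint_union_left.1 hS').2.symm⟩
    have hsub : S ∪ vertexLabels g x ∪ vertexLabels h y
        ⊆ S ∪ vertexLabels h y ∪ vertexLabels g x := (Set.union_right_comm _ _ _).subset
    rcases Nat.lt_or_ge (i + 1) j with hij | hij
    -- A cap and a merge both consume two strands, so positions to their right shift by `g.tgt - 2`.
    · obtain ⟨f', h1, h2⟩ := hl.exchange_left hl' (by omega) (j - 2 + g.tgt) (by omega)
      have e := exch g h i j m (m - 2 + g.tgt) n p (j - 2 + g.tgt) (by omega) hj (by omega)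
        (by omega) (by omega) (by omega)
      have := (ih hg (by omega) (p := m - 2 + g.tgt) (by omega) h1
        (Set.disjoint_union_left.1 hS').1).comp_up hh (n' := p) (by omega) (by omega) h2 hdis
      rw [Category.assoc, e, ← Category.assoc] at *
      exact this.mono hsub
    rcases Nat.lt_or_ge (j + 1) i with hji | hji
    · obtain ⟨f', h1, h2⟩ := hl.exchange_right hl' (by omega) (i - 2 + h.src) (by omega)
      have e := exch h g j (i - 2 + h.src) m n (m - 2 + g.tgt) p i (by omega) (by omega) (by omega)
        (by omega) (by omega) (by omega)
      have := (ih hg (by omega) (p := m - 2 + g.tgt) (by omega) h1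
        (Set.disjoint_union_left.1 hS').1).comp_up hh (n' := p) (by omega) (by omega) h2 hdis
      rw [Category.assoc, e, ← Category.assoc]
      exact this.mono hsub
    have hcase : i = j ∨ i = j + 1 ∨ j = i + 1 := by omega
    have hxy := hl.eq hl' (by omega) (by omega) (by omega) (by omega)
    rw [Category.assoc]
    rcases hh with rfl | rfl <;> rcases hg with rfl | rfl <;>
      simp only [Piece.src, Piece.tgt] at hj hn hp
    · obtain rfl : n = m + 2 := by omega
      obtain rfl : p = m := by omega
      obtain rfl : f₃ = f₁ := hl.cup_cap hl' hji hij
      have hu' := hu.reducible.mono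
        (T := S ∪ vertexLabels .cup y ∪ vertexLabels .cap x) (by
          rw [Set.union_assoc]; exact Set.subset_union_left)
      rcases hcase with rfl | rfl | rfl
      · rw [cup_cap_self _ _ _ (by omega) rfl, Linear.comp_smul, Category.comp_id]
        exact hu'.smul _
      · rwa [cup_cap_right _ _ _ (by omega) rfl, Category.comp_id]
      · rwa [cup_cap_left _ _ _ (by omega) rfl, Category.comp_id]
    · obtain rfl : n = m + 2 := by omega
      obtain rfl : p = m + 1 := by omega
      rcases hcase with rfl | hc
      · exact .inl (by rw [cup_merge_self _ _ _ _ (by omega) rfl rfl, Limits.comp_zero])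
      -- The cup absorbs the merge and becomes a split; the vertex keeps its label.
      have h1 := hl.cup_merge hl' hc
      have h2 := hu.reducible.comp_up (n' := m + 1) (.inr rfl)
        (by simp only [Piece.src]; omega) (by simp only [Piece.src, Piece.tgt]) h1
        (Set.disjoint_union_left.1 hS').1
      have h3 := h2.mono (T := S ∪ vertexLabels .cup y ∪ vertexLabels .merge x)
        (Set.union_subset_union_left _ Set.subset_union_left)
      rcases hc with rfl | rfl
      · rw [min_eq_right (by omega)] at h3
        rwa [cup_merge_right _ _ _ _ (by omega) rfl rfl]
      · rw [min_eq_left (by omega)] at h3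
        rwa [cup_merge_left _ _ _ _ (by omega) rfl rfl]
    · obtain rfl : n = m + 1 := by omega
      rcases hcase with rfl | hc
      · exact .inl (by rw [split_cap_self _ _ _ _ (by omega) rfl (by omega), Limits.comp_zero])
      have h1 := hl.split_cap hl' hc
      -- The split and the cap fuse into a merge, which must be pushed further down.
      have h2 := ih (.inr rfl) (p := p) (by omega)
        (by simp only [Piece.src, Piece.tgt]; omega) h1 hS
      have h3 := h2.mono (T := S ∪ vertexLabels .split y ∪ vertexLabels .cap x)
        Set.subset_union_left
      rcases hc with rfl | rfl
      · rw [min_eq_right (by omega)] at h3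
        rwa [split_cap_right _ _ _ _ (by omega) rfl (by omega)]
      · rw [min_eq_left (by omega)] at h3
        rwa [split_cap_left _ _ _ _ (by omega) rfl (by omega)]
    -- A split touching a merge would give two vertices the same label.
    · exact (Set.disjoint_left.1 hS' (.inr ⟨trivial, hxy⟩) ⟨trivial, rfl⟩).elim

lemma Reducible.comp_el {L : Type*} {r n n' i : ℕ} {f f' : ℕ → L} {T : Set L} {w : ob r ⟶ ob n}
    (hw : Reducible r n f T w) {g : Piece} {x : L} (hi : i + g.src ≤ n)
    (hn : n' + g.src = n + g.tgt) (hl : Labelling g x i f f')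
    (hT : Disjoint T (vertexLabels g x)) :
    Reducible r n' f' (T ∪ vertexLabels g x) (w ≫ el g i n n') := by
  have key : (g = .cup ∨ g = .split) ∨ (g = .cap ∨ g = .merge) := by cases g <;> simp
  rcases key with hg | hg
  · exact hw.comp_up hg hi hn hl hT
  · have hgs : g.src = 2 := by rcases hg with rfl | rfl <;> rfl
    rcases hw with rfl | ⟨c, k, d, u, S, hd, hu, hS, rfl⟩
    · exact .inl (by simp)
    · have := hu.comp_down hg (p := n') (by omega) hn hl (hT.mono_left hS)
      rw [Linear.smul_comp, Category.assoc]
      exact ((this.mono (Set.union_subset_union_left _ hS)).down_comp hd).smul c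

/-! ## Labelling the strands of a diagram by its components -/

section
variable {m n : ℕ}

/-- Two strands are connected by a curve within a layer, or end at the same vertex. -/
def ComponentStep (D : Diagram m n) (p p' : ℕ × ℕ) : Prop :=
  EdgeStep D p p' ∨ ∃ k, EndsAtVertex D p k ∧ EndsAtVertex D p' k

/-- The connected component of a strand. -/
def component (D : Diagram m n) (p : ℕ × ℕ) : Quot (ComponentStep D) := Quot.mk _ p

lemma component_eq_of_edgeStep {D : Diagram m n} {p p' : ℕ × ℕ} (h : EdgeStep D p p') :
    component D p = component D p' := Quot.sound (.inl h)

lemma component_eq_of_endsAtVertex {D : Diagram m n} {p p' : ℕ × ℕ} {k : ℕ}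
    (h : EndsAtVertex D p k) (h' : EndsAtVertex D p' k) : component D p = component D p' :=
  Quot.sound (.inr ⟨k, h, h'⟩)

lemma sameComponent_of_component_eq {D : Diagram m n} {p p' : ℕ × ℕ}
    (h : component D p = component D p') : SameComponent D p p' :=
  Quot.eqvGen_exact h

/-- The components of the `w` strands met by the line `k`. -/
def componentAt (D : Diagram m n) (k w j : ℕ) : Option (Quot (ComponentStep D)) :=
  if j < w then some (component D (k, j)) else none

lemma componentAt_of_lt (D : Diagram m n) {k w j : ℕ} (h : j < w) :
    componentAt D k w j = some (component D (k, j)) := if_pos h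

/-- The ends of a cup or cap lie on one edge, and those of a vertex meet there, so each piece lies
in a single component. -/
lemma labelling_of_layerAt {D : Diagram m n} {k a b : ℕ} {g : Piece} (h : LayerAt D k g a b)
    {w w' : ℕ} (hw : w = a + g.src + b) (hw' : w' = a + g.tgt + b) :
    ∃ p, Labelling g (some (component D p)) a (componentAt D k w) (componentAt D (k + 1) w') ∧
      (g.IsVertex → EndsAtVertex D p k) := by
  have hleft : ∀ j < a, componentAt D (k + 1) w' j = componentAt D k w j := fun j hj => by
    rw [componentAt_of_lt D (by omega), componentAt_of_lt D (by omega),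
      component_eq_of_edgeStep (EdgeStep.left j h hj)]
  have hright : ∀ j j', a + g.src ≤ j → j' + g.src = j + g.tgt →
      componentAt D (k + 1) w' j' = componentAt D k w j := fun j j' hj hj' => by
    rcases Nat.lt_or_ge j w with hc | hc
    · have e := component_eq_of_edgeStep (EdgeStep.right (j - (a + g.src)) h (by omega))
      rw [Nat.add_sub_cancel' hj, show a + g.tgt + (j - (a + g.src)) = j' by omega] at e
      rw [componentAt_of_lt D (by omega), componentAt_of_lt D hc, e]
    -- Past the last strand both labels are `none`, so the condition holds at all positions.
    · rw [componentAt, componentAt, if_neg (by omega), if_neg (by omega)]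
  have hvertex : g.IsVertex → 0 < g.src → ∃ p,
      Labelling g (some (component D p)) a (componentAt D k w) (componentAt D (k + 1) w') ∧
      (g.IsVertex → EndsAtVertex D p k) := fun hv h0 => by
    have h1 := EndsAtVertex.below 0 h hv h0
    refine ⟨(k, a + 0), ⟨hleft, hright, fun j hj hj' => ?_, fun j hj hj' => ?_⟩, fun _ => h1⟩
    · have e := component_eq_of_endsAtVertex (EndsAtVertex.below (j - a) h hv (by omega)) h1
      rw [Nat.add_sub_cancel' hj] at e
      rw [componentAt_of_lt D (by omega), e]
    · have e := component_eq_of_endsAtVertex (EndsAtVertex.above (j - a) h hv (by omega)) h1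
      rw [Nat.add_sub_cancel' hj] at e
      rw [componentAt_of_lt D (by omega), e]
  cases g with
  | cup =>
    refine ⟨(k + 1, a), ⟨hleft, hright, fun j hj hj' => ?_, fun j hj hj' => ?_⟩, False.elim⟩
    · simp only [Piece.src] at hj'
      omega
    · simp only [Piece.tgt] at hj' hw'
      rw [componentAt_of_lt D (by omega)]
      obtain rfl | rfl : j = a ∨ j = a + 1 := by omega
      · rfl
      · rw [component_eq_of_edgeStep (EdgeStep.cup h)]
  | cap =>
    refine ⟨(k, a), ⟨hleft, hright, fun j hj hj' => ?_, fun j hj hj' => ?_⟩, False.elim⟩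
    · simp only [Piece.src] at hj' hw
      rw [componentAt_of_lt D (by omega)]
      obtain rfl | rfl : j = a ∨ j = a + 1 := by omega
      · rfl
      · rw [component_eq_of_edgeStep (EdgeStep.cap h)]
    · simp only [Piece.tgt] at hj'
      omega
  | merge => exact hvertex trivial (by decide)
  | split => exact hvertex trivial (by decide)

lemma length_layers {X Y : Points} (Q : Quiver.Path X Y) : (layers Q).length = Q.length := by
  induction Q with
  | nil => rfl
  | cons Q l ih => simp [layers, ih]

/-- A path of layers, as a morphism of the spider. -/
def pathMorphism {Y : Points} (Q : Quiver.Path (Points.mk m) Y) : ob m ⟶ ob Y.count :=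
  toSpider (m := m) (n := Y.count) Q

lemma pathMorphism_nil :
    pathMorphism (Quiver.Path.nil : Quiver.Path (Points.mk m) (Points.mk m)) = 𝟙 (ob m) :=
  toSpider_id m

lemma pathMorphism_cons {Y Z : Points} (Q : Quiver.Path (Points.mk m) Y) (l : Layer Y Z) :
    pathMorphism (Q.cons l) = pathMorphism Q ≫ el l.piece l.left Y.count Z.count := by
  rw [← el_eq l.piece l.left l.right Y.count Z.count l.bottom_eq l.top_eq]
  exact toSpider_comp (m := m) (n := Y.count) (p := Z.count) Q
    (layer l.piece l.left l.right Y.count Z.count l.bottom_eq l.top_eq)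

/-- Layers are added one at a time; the label set consists of the components of the vertices met so
far. -/
lemma reducible_of_path {D : Diagram m n} (hD : AtMostOneVertexPerComponent D) {Y : Points}
    (Q : Quiver.Path (Points.mk m) Y)
    (hQ : ∀ k g a b, (layers Q)[k]? = some (g, a, b) → LayerAt D k g a b) :
    Reducible m Y.count (componentAt D Q.length Y.count)
      {y | ∃ k < Q.length, ∃ p, EndsAtVertex D p k ∧ y = some (component D p)}
      (pathMorphism Q) := by
  induction Q with
  | nil =>
    rw [pathMorphism_nil]
    exact (LabelledUpWord.id _).reducible.mono (Set.empty_subset _)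
  | @cons Y Z Q l ih =>
    have hlen := length_layers Q
    have hl : LayerAt D Q.length l.piece l.left l.right := hQ _ _ _ _ (by
      rw [layers, List.getElem?_append_right (by omega), hlen, Nat.sub_self]
      rfl)
    have hQ' := ih fun k g a b hk => hQ k g a b (by
      rw [layers, List.getElem?_append_left (by
        obtain ⟨h, -⟩ := List.getElem?_eq_some_iff.1 hk
        exact h), hk])
    obtain ⟨p, hp, hv⟩ := labelling_of_layerAt hl l.bottom_eq l.top_eq
    rw [pathMorphism_cons]
    have hle := l.bottom_eq
    have hle' := l.top_eq
    refine (hQ'.comp_el (by omega) (by omega) hp ?_).mono ?_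
    · refine Set.disjoint_left.2 ?_
      rintro y ⟨k, hk, p', hp', rfl⟩ ⟨hg, e⟩
      -- A repeated label would place the new vertex in the component of an earlier one.
      exact hk.ne (hD k _ p' p hp' (hv hg) (sameComponent_of_component_eq (Option.some.inj e)))
    · rintro y (⟨k, hk, p', hp', rfl⟩ | ⟨hg, rfl⟩)
      · exact ⟨k, Nat.lt_succ_of_lt hk, p', hp', rfl⟩
      · exact ⟨Q.length, Nat.lt_succ_self _, p, hv hg, rfl⟩

end

lemma gen_toSpider {n : ℕ} {D : Diagram n n} (hD : AtMostOneVertexPerComponent D) :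
    Gen n (toSpider D) := by
  have h : Reducible n n _ _ (toSpider D) := reducible_of_path hD (Y := ⟨n⟩) D fun _ _ _ _ h => h
  rcases h with h | ⟨c, k, d, u, S, hd, hu, -, e⟩
  · rw [h]
    exact Gen.zero n
  · rw [e]
    exact (hd.comp_upWord hu.upWord).smul c

end G2

end

/-- For every `n` the generators `σ_i` act on the diagram algebra of the `G₂` spider by crossings;
this defines the map from the braid group algebra, and its image contains every basis diagram in
which each connected component has at most one vertex. -/
theorem mainTheorem2 (n : ℕ) :
    ∃ ρ : MonoidAlgebra G2.Coeff (G2.BraidGroup n) →ₐ[G2.Coeff] G2.EndAlg n,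
      (∀ i : Fin (n - 1),
        ρ (MonoidAlgebra.of G2.Coeff (G2.BraidGroup n) (G2.braidGen n i)) = G2.crossing n i) ∧
      ∀ D : G2.Diagram n n, G2.IsBasisDiagram D → G2.AtMostOneVertexPerComponent D →
        (G2.toSpider D : G2.EndAlg n) ∈ ρ.range :=
  ⟨G2.braidAlgHom n, G2.braidAlgHom_of n,
    fun _ _ hD => G2.crAlg_le_range n (G2.gen_toSpider hD)⟩
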